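/- Let $A\subset\mathbb{C}$ be compact with Hausdorff dimension $\dim A>0$, and let $1<s<1+\dim A$. Identify $x+\mathrm{i}y\in\mathbb{C}$ with $(x,y,0)\in\mathbb{R}^3$, let $\mathbf{R}_\phi$ be the rotation of $\mathbb{R}^3$ by the angle $\phi$ about the $y$-axis, and put $$\mathcal{K}_s(z,w)=\frac1{2\pi}\int_0^{2\pi}\frac{d\phi}{|\mathbf{R}_\phi z-w|^{s}},\qquad \mathcal{K}_s^{(R)}(z,w)=2R\,\mathcal{K}_s(R+z,R+w)\quad(R>0),$$ $$\mathcal{K}_s^{(\infty)}(z,w)=\frac{\Gamma((s-1)/2)}{\sqrt\pi\,\Gamma(s/2)}\,\frac1{|z-w|^{s-1}},$$ with values in $[0,\infty]$. Let $\mathcal{M}(A)$ be the set of Borel probability measures supported on $A$. An equilibrium measure on $A$ for a kernel $\mathcal{K}$ is a $\mu\in\mathcal{M}(A)$ that minimizes the energy $\iint\mathcal{K}(z,w)\,d\mu(z)\,d\mu(w)$ over $\mathcal{M}(A)$. Then there is a unique equilibrium measure $\lambda_{s,A}^{\infty}$ on $A$ for $\mathcal{K}_s^{(\infty)}$; for every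 $R>0$ such that $R+A$ lies in the open right half-plane $\{\operatorname{Re} z>0\}$ (hence for all sufficiently large $R$) there is a unique equilibrium measure $\lambda_{s,A}^{R}$ on $A$ for $\mathcal{K}_s^{(R)}$; and $\lambda_{s,A}^{R}$ converges weak-star to $\lambda_{s,A}^{\infty}$ as $R\to\infty$. -/

import Mathlib

noncomputable section

namespace Revolution

open MeasureTheory

/-- The reference half-plane (complex numbers) inside `ℝ³`: the point `x + i y` is placed at
`(x, y, 0)`. The axis of revolution is the second coordinate axis. -/
def embed (z : ℂ) : EuclideanSpace ℝ (Fin 3) :=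
  !₂[z.re, z.im, 0]

/-- The rotation `𝐑_φ` of `ℝ³` by the angle `φ` about the second coordinate axis. -/
def rot (φ : ℝ) (p : EuclideanSpace ℝ (Fin 3)) : EuclideanSpace ℝ (Fin 3) :=
  !₂[Real.cos φ * p 0 + Real.sin φ * p 2, p 1, -Real.sin φ * p 0 + Real.cos φ * p 2]

/-- The kernel `𝒦_s(z, w) = (1 / 2π) ∫_0^{2π} |𝐑_φ z - w|^{-s} dφ`, with values in `[0, ∞]`. -/
def kernel (s : ℝ) (z w : ℂ) : ENNReal :=
  ENNReal.ofReal (1 / (2 * Real.pi)) *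
    ∫⁻ φ in Set.Ico (0 : ℝ) (2 * Real.pi), ‖rot φ (embed z) - embed w‖ₑ ^ (-s)

/-- The rescaled translated kernel `𝒦_s^{(R)}(z, w) = 2 R 𝒦_s(R + z, R + w)` (for `s > 1`,
`R > 0`). -/
def kernelAt (s R : ℝ) (z w : ℂ) : ENNReal :=
  ENNReal.ofReal (2 * R) * kernel s ((R : ℂ) + z) ((R : ℂ) + w)

/-- The limit kernel
`𝒦_s^{(∞)}(z, w) = Γ((s - 1) / 2) / (√π Γ(s / 2)) · |z - w|^{1 - s}` (for `s > 1`), with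
value `∞` on the diagonal. -/
def kernelInfty (s : ℝ) (z w : ℂ) : ENNReal :=
  ENNReal.ofReal (Real.Gamma ((s - 1) / 2) / (Real.sqrt Real.pi * Real.Gamma (s / 2))) *
    ‖z - w‖ₑ ^ (1 - s)

/-- The energy `𝒥_K[μ] = ∬ K(z, w) dμ(z) dμ(w)` of a nonnegative kernel `K`. -/
def energy (K : ℂ → ℂ → ENNReal) (μ : ProbabilityMeasure ℂ) : ENNReal :=
  ∫⁻ w, ∫⁻ z, K z w ∂(μ : Measure ℂ) ∂(μ : Measure ℂ)

/-- The class `ℳ(A)` of Borel probability measures on the plane that are supported on the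
(closed) set `A`. -/
def measuresOn (A : Set ℂ) : Set (ProbabilityMeasure ℂ) :=
  {μ | (μ : Measure ℂ) Aᶜ = 0}

/-- `μ` is an equilibrium measure on `A` for the kernel `K`: it belongs to `ℳ(A)` and has
least `K`-energy among all members of `ℳ(A)`. -/
def IsEquilibrium (A : Set ℂ) (K : ℂ → ℂ → ENNReal) (μ : ProbabilityMeasure ℂ) : Prop :=
  μ ∈ measuresOn A ∧ ∀ ν ∈ measuresOn A, energy K μ ≤ energy K ν

end Revolution

end

namespace Revolution

open MeasureTheory Filter Topology Set
open scoped ENNReal NNReal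

/-! Existence is the direct method. `measuresOn A` is compact by Prokhorov, and both energies are
lower semicontinuous because each kernel is an integral over a parameter of continuous kernels, so
Fatou applies (`lowerSemicontinuous_energy_lintegral`).

Uniqueness comes from strict positive definiteness of Riesz kernels (`eq_of_rieszEnergy_le`). A
Gamma integral writes the Riesz kernel as a mixture of Gaussians, and each Gaussian is a convolution
of two Gaussians, so mutual energies become inner products of Gaussian potentials. Two minimizers
have mutual energy at least the minimum, hence equal potentials, and a finite measure is determined
by its convolution with one Gaussian. For the limit kernel this is used in the plane with exponent
`s - 1`. For `kernelAt` it is used in `ℝ³` with exponent `s`, after spinning a planar measure into a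
measure of revolution (`mutualEnergy_revolve`); spinning is injective for sets on one side of the
axis (`eq_of_revolve_eq`).

Some measure on `A` has finite energy because `s - 1 < dimH A`. This Frostman-type statement
(`exists_rieszEnergy_ne_top`) is obtained variationally: minimizers for truncated kernels have large
potential on all of `A`; if their energies were too large, every point would carry a ball of large
mass, and a Vitali covering would make the Hausdorff content of `A` too small.

For the limit, put `u = R φ`. Both kernels become integrals against `du / π`, and the integrand
tends to `(|z - w|² + u²)^(-s/2)`. Domination gives convergence of the energy of a fixed measure
(`tendsto_energy_kernelAt`); a reverse comparison with constant tending to 1 gives a lower bound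
along varying measures (`energy_kernelInfty_le_liminf`). Hence every cluster point of the
equilibrium measures minimizes the limit energy, and uniqueness with compactness gives convergence.
-/

/-! ### Energies: semicontinuity, compactness, existence and uniqueness of minimizers -/

/-- The mutualEnergy energy `∬ K(z, w) dμ(z) dν(w)` of two measures. -/
noncomputable def mutualEnergy {X : Type*} [MeasurableSpace X] (K : X → X → ℝ≥0∞) (μ ν : Measure X) :
    ℝ≥0∞ :=
  ∫⁻ w, ∫⁻ z, K z w ∂μ ∂ν

lemma mutualEnergy_eq_lintegral_prod {X : Type*} [MeasurableSpace X] {K : X → X → ℝ≥0∞}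
    (hK : Measurable (Function.uncurry K)) (μ ν : Measure X) [SFinite μ] [SFinite ν] :
    mutualEnergy K μ ν = ∫⁻ p, K p.1 p.2 ∂(μ.prod ν) :=
  (lintegral_prod_symm' _ hK).symm

lemma mutualEnergy_comm {X : Type*} [MeasurableSpace X] {K : X → X → ℝ≥0∞}
    (hK : Measurable (Function.uncurry K)) (hsymm : ∀ x y, K x y = K y x)
    (μ ν : Measure X) [SFinite μ] [SFinite ν] : mutualEnergy K μ ν = mutualEnergy K ν μ := by
  unfold mutualEnergy
  rw [lintegral_lintegral_swap (by exact (hK.comp measurable_swap).aemeasurable)]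
  simp_rw [hsymm]

lemma energy_eq_mutualEnergy (K : ℂ → ℂ → ℝ≥0∞) (μ : ProbabilityMeasure ℂ) :
    energy K μ = mutualEnergy K (μ : Measure ℂ) (μ : Measure ℂ) := rfl

lemma iSup_min_natCast (x : ℝ≥0∞) : ⨆ n : ℕ, min x n = x := by
  refine le_antisymm (iSup_le fun n => min_le_left _ _) (le_of_forall_lt fun c hc => ?_)
  obtain ⟨n, hn⟩ := ENNReal.exists_nat_gt hc.ne_top
  exact lt_of_lt_of_le (lt_min hc hn) (le_iSup (fun n : ℕ => min x n) n)

/-- The truncations `min f n` are bounded and continuous, so their integrals are weak-star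
continuous; the integral of `f` is the supremum of these. -/
lemma lowerSemicontinuous_lintegral {X : Type*} [TopologicalSpace X] [MeasurableSpace X]
    [OpensMeasurableSpace X] {f : X → ℝ≥0∞} (hf : Continuous f) :
    LowerSemicontinuous fun μ : ProbabilityMeasure X => ∫⁻ x, f x ∂(μ : Measure X) := by
  have key : ∀ μ : ProbabilityMeasure X,
      ∫⁻ x, f x ∂(μ : Measure X) = ⨆ n : ℕ, ∫⁻ x, min (f x) n ∂(μ : Measure X) := by
    intro μ
    rw [← lintegral_iSup (fun n => hf.measurable.min measurable_const)
      fun n m hnm x => min_le_min le_rfl (by exact_mod_cast hnm)]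
    simp_rw [iSup_min_natCast]
  simp_rw [key]
  refine lowerSemicontinuous_iSup fun n => Continuous.lowerSemicontinuous ?_
  have hfin : ∀ x, min (f x) (n : ℝ≥0∞) ≠ ∞ := fun x =>
    ne_top_of_le_ne_top (ENNReal.natCast_ne_top n) (min_le_right _ _)
  let g : BoundedContinuousFunction X ℝ≥0 :=
    BoundedContinuousFunction.mkOfBound
      ⟨fun x => (min (f x) (n : ℝ≥0∞)).toNNReal,
        ENNReal.continuousOn_toNNReal.comp_continuous (hf.min continuous_const) hfin⟩ n (by
        intro x y
        simp only [ContinuousMap.coe_mk]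
        have hle : ∀ x, (min (f x) (n : ℝ≥0∞)).toNNReal ≤ n := fun x =>
          ENNReal.toNNReal_mono (ENNReal.natCast_ne_top n) (min_le_right _ _)
        have hx := hle x
        have hy := hle y
        rw [NNReal.dist_eq, abs_le]
        have hx' : ((min (f x) (n : ℝ≥0∞)).toNNReal : ℝ) ≤ n := by exact_mod_cast hx
        have hy' : ((min (f y) (n : ℝ≥0∞)).toNNReal : ℝ) ≤ n := by exact_mod_cast hy
        constructor <;>
          linarith [NNReal.coe_nonneg (min (f x) (n : ℝ≥0∞)).toNNReal,
            NNReal.coe_nonneg (min (f y) (n : ℝ≥0∞)).toNNReal])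
  have hg : ∀ x, min (f x) (n : ℝ≥0∞) = (g x : ℝ≥0∞) := fun x =>
    (ENNReal.coe_toNNReal (hfin x)).symm
  simp_rw [hg]
  refine continuous_iff_continuousAt.2 fun μ => ?_
  exact ProbabilityMeasure.tendsto_iff_forall_lintegral_tendsto.1 tendsto_id g

lemma lowerSemicontinuous_lintegral_prod {K : ℂ → ℂ → ℝ≥0∞}
    (hK : Continuous (Function.uncurry K)) :
    LowerSemicontinuous fun μ : ProbabilityMeasure ℂ =>
      ∫⁻ p, K p.1 p.2 ∂((μ : Measure ℂ).prod (μ : Measure ℂ)) := by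
  have hc : Continuous fun μ : ProbabilityMeasure ℂ => μ.prod μ :=
    ProbabilityMeasure.continuous_prod.comp (continuous_id.prodMk continuous_id)
  exact (lowerSemicontinuous_lintegral hK).comp hc

lemma lowerSemicontinuous_energy {K : ℂ → ℂ → ℝ≥0∞}
    (hK : Continuous (Function.uncurry K)) : LowerSemicontinuous (energy K) := by
  have : energy K = fun μ : ProbabilityMeasure ℂ =>
      ∫⁻ p, K p.1 p.2 ∂((μ : Measure ℂ).prod (μ : Measure ℂ)) := by
    ext μ
    rw [energy_eq_mutualEnergy, mutualEnergy_eq_lintegral_prod hK.measurable]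
  rw [this]
  exact lowerSemicontinuous_lintegral_prod hK

section Param

variable {Θ : Type*} [MeasurableSpace Θ] {m : Measure Θ} [SFinite m] {J : Θ → ℂ → ℂ → ℝ≥0∞}

lemma energy_lintegral (hm : Measurable fun q : Θ × ℂ × ℂ => J q.1 q.2.1 q.2.2)
    (μ : ProbabilityMeasure ℂ) :
    energy (fun z w => ∫⁻ θ, J θ z w ∂m) μ =
      ∫⁻ θ, ∫⁻ p, J θ p.1 p.2 ∂((μ : Measure ℂ).prod (μ : Measure ℂ)) ∂m := by
  have h1 : Measurable fun q : (ℂ × ℂ) × Θ => J q.2 q.1.1 q.1.2 := hm.comp measurable_swap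
  rw [energy_eq_mutualEnergy, mutualEnergy_eq_lintegral_prod (by exact h1.lintegral_prod_right'),
    lintegral_lintegral_swap h1.aemeasurable]

/-- Fatou in the parameter along `𝓝 μ`. This avoids any continuity statement for the integrated
kernel itself. -/
lemma lowerSemicontinuous_energy_lintegral
    (hc : ∀ θ, Continuous (Function.uncurry (J θ)))
    (hm : Measurable fun q : Θ × ℂ × ℂ => J q.1 q.2.1 q.2.2) :
    LowerSemicontinuous (energy fun z w => ∫⁻ θ, J θ z w ∂m) := by
  rw [show (energy fun z w => ∫⁻ θ, J θ z w ∂m) = fun μ : ProbabilityMeasure ℂ => _ from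
    funext (energy_lintegral hm), lowerSemicontinuous_iff_le_liminf]
  intro μ
  refine le_trans (lintegral_mono fun θ =>
    (lowerSemicontinuous_lintegral_prod (hc θ)).le_liminf μ) (lintegral_liminf_le fun ν => ?_)
  exact hm.lintegral_prod_right'

end Param

/-- Prokhorov's theorem with the constant sequence of compact sets `A` and zero allowed mass
outside. -/
lemma isCompact_measuresOn {A : Set ℂ} (hA : IsCompact A) : IsCompact (measuresOn A) := by
  have h := isCompact_setOfPred_probabilityMeasure_mass_eq_compl_isCompact_le
    (u := fun _ => (0 : ℝ≥0)) (K := fun _ : ℕ => A) tendsto_const_nhds (fun _ => hA)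
    (Or.inl inferInstance)
  convert h using 1
  ext μ
  simp [measuresOn, ProbabilityMeasure.null_iff_toMeasure_null]

lemma measuresOn_nonempty {A : Set ℂ} (hA : IsClosed A) (hne : A.Nonempty) :
    (measuresOn A).Nonempty := by
  obtain ⟨z, hz⟩ := hne
  refine ⟨⟨Measure.dirac z, inferInstance⟩, ?_⟩
  change Measure.dirac z Aᶜ = 0
  simp [Measure.dirac_apply' _ hA.measurableSet.compl, hz]

/-- The convex combination of two probability measures. -/
noncomputable def mix {X : Type*} [MeasurableSpace X] (a b : ℝ≥0∞) (hab : a + b = 1)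
    (μ ν : ProbabilityMeasure X) : ProbabilityMeasure X :=
  ⟨a • (μ : Measure X) + b • (ν : Measure X), ⟨by simp [hab]⟩⟩

lemma mix_mem_measuresOn {A : Set ℂ} {a b : ℝ≥0∞} (hab : a + b = 1) {μ ν : ProbabilityMeasure ℂ}
    (hμ : μ ∈ measuresOn A) (hν : ν ∈ measuresOn A) : mix a b hab μ ν ∈ measuresOn A := by
  have h1 : (μ : Measure ℂ) Aᶜ = 0 := hμ
  have h2 : (ν : Measure ℂ) Aᶜ = 0 := hν
  change (a • (μ : Measure ℂ) + b • (ν : Measure ℂ)) Aᶜ = 0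
  simp [h1, h2]

lemma energy_mix {K : ℂ → ℂ → ℝ≥0∞} (hK : Measurable (Function.uncurry K))
    (hsymm : ∀ x y, K x y = K y x) {a b : ℝ≥0∞} (hab : a + b = 1) (μ ν : ProbabilityMeasure ℂ) :
    energy K (mix a b hab μ ν) = a * a * energy K μ +
      2 * (a * b * mutualEnergy K (μ : Measure ℂ) (ν : Measure ℂ)) + b * b * energy K ν := by
  have hc := mutualEnergy_comm hK hsymm (μ : Measure ℂ) (ν : Measure ℂ)
  have hmeas : ∀ ρ : ProbabilityMeasure ℂ, Measurable fun w => ∫⁻ z, K z w ∂(ρ : Measure ℂ) :=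
    fun ρ => by exact (hK.comp measurable_swap).lintegral_prod_right'
  have h : energy K (mix a b hab μ ν) =
      a * (a * energy K μ + b * mutualEnergy K (ν : Measure ℂ) (μ : Measure ℂ)) +
      b * (a * mutualEnergy K (μ : Measure ℂ) (ν : Measure ℂ) + b * energy K ν) := by
    change ∫⁻ w, ∫⁻ z, K z w ∂(a • (μ : Measure ℂ) + b • (ν : Measure ℂ))
      ∂(a • (μ : Measure ℂ) + b • (ν : Measure ℂ)) = _
    simp only [lintegral_add_measure, lintegral_smul_measure, smul_eq_mul]
    rw [lintegral_add_left ((hmeas μ).const_mul a), lintegral_add_left ((hmeas μ).const_mul a),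
      lintegral_const_mul _ (hmeas μ), lintegral_const_mul _ (hmeas μ),
      lintegral_const_mul _ (hmeas ν), lintegral_const_mul _ (hmeas ν)]
    rfl
  rw [h, ← hc]
  ring

/-- `hdef` is strict positive definiteness phrased without subtraction, since energies may be
infinite. Testing minimality on the midpoint of two minimizers of energy `e` gives `e ≤ e/4 + b/2 +
e/4`, so their mutual energy `b` is at least `e`, and `hdef` applies. -/
lemma existsUnique_isEquilibrium {A : Set ℂ} (hA : IsCompact A) {K : ℂ → ℂ → ℝ≥0∞}
    (hK : Measurable (Function.uncurry K)) (hsymm : ∀ x y, K x y = K y x)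
    (hlsc : LowerSemicontinuous (energy K)) (hfin : ∃ ν ∈ measuresOn A, energy K ν ≠ ∞)
    (hdef : ∀ μ ∈ measuresOn A, ∀ ν ∈ measuresOn A, ∀ e : ℝ≥0∞, e ≠ ∞ →
      energy K μ ≤ e → energy K ν ≤ e → e ≤ mutualEnergy K (μ : Measure ℂ) (ν : Measure ℂ) → μ = ν) :
    ∃! μ : ProbabilityMeasure ℂ, IsEquilibrium A K μ := by
  obtain ⟨ν₀, hν₀, hν₀fin⟩ := hfin
  obtain ⟨μ, hμ, hmin⟩ := (hlsc.lowerSemicontinuousOn (measuresOn A)).exists_isMinOn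
    ⟨ν₀, hν₀⟩ (isCompact_measuresOn hA)
  rw [isMinOn_iff] at hmin
  have hμfin : energy K μ ≠ ∞ := ne_top_of_le_ne_top hν₀fin (hmin ν₀ hν₀)
  refine ⟨μ, ⟨hμ, hmin⟩, fun ν hν => ?_⟩
  have heq : energy K ν = energy K μ := le_antisymm (hν.2 μ hμ) (hmin ν hν.1)
  refine hdef ν hν.1 μ hμ (energy K μ) hμfin heq.le le_rfl ?_
  have hmid := hmin _ (mix_mem_measuresOn ENNReal.inv_two_add_inv_two hν.1 hμ)
  rw [energy_mix hK hsymm, heq] at hmid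
  by_cases htop : mutualEnergy K (ν : Measure ℂ) (μ : Measure ℂ) = ∞
  · rw [htop]; exact le_top
  lift energy K μ to ℝ≥0 using hμfin with e
  lift mutualEnergy K (ν : Measure ℂ) (μ : Measure ℂ) to ℝ≥0 using htop with b
  have h2 : (2⁻¹ : ℝ≥0∞) = ((2⁻¹ : ℝ≥0) : ℝ≥0∞) := by simp
  rw [h2] at hmid
  have hmid' : e ≤ 2⁻¹ * 2⁻¹ * e + 2 * (2⁻¹ * 2⁻¹ * b) + 2⁻¹ * 2⁻¹ * e := by exact_mod_cast hmid
  have : e ≤ b := by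
    rw [← NNReal.coe_le_coe] at hmid' ⊢
    push_cast at hmid'
    linarith
  exact_mod_cast this

/-! ### Gaussian decomposition and strict positive definiteness of Riesz kernels -/

lemma lintegral_rpow_mul_exp_neg {a : ℝ} (ha : 0 < a) {q : ℝ} (hq : 0 ≤ q) :
    ∫⁻ r in Ioi (0 : ℝ), ENNReal.ofReal (r ^ (a - 1) * Real.exp (-(q * r))) =
      ENNReal.ofReal (Real.Gamma a) * ENNReal.ofReal q ^ (-a) := by
  have hpos : ∀ q : ℝ, 0 < q →
      ∫⁻ r in Ioi (0 : ℝ), ENNReal.ofReal (r ^ (a - 1) * Real.exp (-(q * r))) =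
        ENNReal.ofReal (Real.Gamma a) * ENNReal.ofReal q ^ (-a) := by
    intro q hq
    have hI := Real.integral_rpow_mul_exp_neg_mul_Ioi ha hq
    have hG := Real.Gamma_pos_of_pos ha
    rw [← ofReal_integral_eq_lintegral_ofReal, hI, mul_comm, ENNReal.ofReal_mul hG.le,
      ENNReal.ofReal_rpow_of_pos hq, one_div, Real.inv_rpow hq.le, Real.rpow_neg hq.le]
    · by_contra h
      rw [integral_undef h] at hI
      have : 0 < (1 / q) ^ a * Real.Gamma a := by positivity
      linarith
    · filter_upwards [ae_restrict_mem measurableSet_Ioi] with r hr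
      have : (0 : ℝ) < r := hr
      positivity
  -- At `q = 0` both sides are `∞`: the integral there dominates the integrals for `q > 0`, whose
  -- values blow up as `q` decreases to 0.
  rcases hq.eq_or_lt with rfl | hq
  · have hG : ENNReal.ofReal (Real.Gamma a) ≠ 0 := by
      simpa using Real.Gamma_pos_of_pos ha
    have hlim : Tendsto (fun q : ℝ => ENNReal.ofReal (Real.Gamma a) * ENNReal.ofReal q ^ (-a))
        (𝓝[>] 0) (𝓝 ∞) := by
      have h1 : Tendsto (fun q : ℝ => ENNReal.ofReal q ^ (-a)) (𝓝[>] 0) (𝓝 ∞) := by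
        have h2 : Continuous fun q : ℝ => ENNReal.ofReal q ^ (-a) :=
          ENNReal.continuous_rpow_const.comp ENNReal.continuous_ofReal
        have h3 := h2.tendsto 0
        rw [ENNReal.ofReal_zero, ENNReal.zero_rpow_of_neg (by linarith)] at h3
        exact h3.mono_left nhdsWithin_le_nhds
      have := ENNReal.Tendsto.const_mul (a := ENNReal.ofReal (Real.Gamma a)) h1
        (Or.inl ENNReal.top_ne_zero)
      rwa [ENNReal.mul_top hG] at this
    rw [ENNReal.ofReal_zero, ENNReal.zero_rpow_of_neg (by linarith), ENNReal.mul_top hG]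
    refine top_le_iff.1 (le_of_tendsto hlim ?_)
    filter_upwards [self_mem_nhdsWithin] with q hq
    rw [← hpos q hq]
    refine lintegral_mono_ae ?_
    filter_upwards [ae_restrict_mem measurableSet_Ioi] with r hr
    have hq' : (0 : ℝ) < q := hq
    have hr' : (0 : ℝ) < r := hr
    refine ENNReal.ofReal_le_ofReal ?_
    gcongr
  · exact hpos q hq

section Euclidean

variable {E : Type*} [NormedAddCommGroup E] [InnerProductSpace ℝ E] [FiniteDimensional ℝ E]
  [MeasurableSpace E] [BorelSpace E]

open scoped RealInnerProductSpace in
lemma integrable_exp_neg_mul_sq_norm {b : ℝ} (hb : 0 < b) :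
    Integrable fun u : E => Real.exp (-b * ‖u‖ ^ 2) := by
  have h := (GaussianFourier.integrable_cexp_neg_mul_sq_norm_add (b := (b : ℂ)) (by simpa using hb)
    0 (0 : E)).re
  refine h.congr (Eventually.of_forall fun u => ?_)
  have : -(b : ℂ) * (‖u‖ : ℂ) ^ 2 + 0 * ((⟪(0 : E), u⟫ : ℝ) : ℂ) = ((-b * ‖u‖ ^ 2 : ℝ) : ℂ) := by
    push_cast; ring
  change (Complex.exp _).re = _
  rw [this, Complex.exp_ofReal_re]

variable (E) in
lemma lintegral_exp_neg_mul_sq_norm {b : ℝ} (hb : 0 < b) :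
    ∫⁻ u : E, ENNReal.ofReal (Real.exp (-b * ‖u‖ ^ 2)) =
      ENNReal.ofReal ((Real.pi / b) ^ (Module.finrank ℝ E / 2 : ℝ)) := by
  rw [← ofReal_integral_eq_lintegral_ofReal (integrable_exp_neg_mul_sq_norm hb)
    (Eventually.of_forall fun u => (Real.exp_pos _).le),
    GaussianFourier.integral_rexp_neg_mul_sq_norm hb]

lemma lintegral_gaussian_mul_gaussian {r : ℝ} (hr : 0 < r) (x y : E) :
    ∫⁻ u : E, ENNReal.ofReal (Real.exp (-(2 * r) * ‖x - u‖ ^ 2) *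
        Real.exp (-(2 * r) * ‖y - u‖ ^ 2)) =
      ENNReal.ofReal (Real.exp (-(‖x - y‖ ^ 2 * r)) *
        (Real.pi / (4 * r)) ^ (Module.finrank ℝ E / 2 : ℝ)) := by
  have key : ∀ u : E, ENNReal.ofReal (Real.exp (-(2 * r) * ‖x - u‖ ^ 2) *
      Real.exp (-(2 * r) * ‖y - u‖ ^ 2)) = ENNReal.ofReal (Real.exp (-(‖x - y‖ ^ 2 * r))) *
        ENNReal.ofReal (Real.exp (-(4 * r) * ‖u - (2⁻¹ : ℝ) • (x + y)‖ ^ 2)) := by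
    intro u
    rw [← ENNReal.ofReal_mul (Real.exp_pos _).le, ← Real.exp_add, ← Real.exp_add]
    congr 2
    -- The parallelogram law completes the square: as a function of `u`, the product is a Gaussian
    -- centred at the midpoint of `x` and `y`.
    have h := parallelogram_law_with_norm ℝ (x - u) (y - u)
    have h1 : x - u + (y - u) = (-2 : ℝ) • (u - (2⁻¹ : ℝ) • (x + y)) := by module
    have h2 : x - u - (y - u) = x - y := by abel
    rw [h1, h2, norm_smul, Real.norm_eq_abs, abs_neg, abs_two] at h
    linear_combination r * h
  simp_rw [key]
  rw [lintegral_const_mul' _ _ ENNReal.ofReal_ne_top, lintegral_sub_right_eq_self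
    (fun u : E => ENNReal.ofReal (Real.exp (-(4 * r) * ‖u‖ ^ 2))),
    lintegral_exp_neg_mul_sq_norm E (by positivity), ← ENNReal.ofReal_mul (Real.exp_pos _).le]

/-- The square root of the Riesz kernel `|x - y|^{-s}`, as a function of `x` and a parameter
`(r, u)`. -/
@[irreducible] noncomputable def rieszFactor (s : ℝ) (x : E) (q : ℝ × E) : ℝ≥0∞ :=
  ENNReal.ofReal (√(q.1 ^ (s / 2 - 1) / (Real.pi / (4 * q.1)) ^ (Module.finrank ℝ E / 2 : ℝ)) *
    Real.exp (-(2 * q.1) * ‖x - q.2‖ ^ 2))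

lemma measurable_rieszFactor (s : ℝ) :
    Measurable fun p : E × (ℝ × E) => rieszFactor s p.1 p.2 := by
  unfold rieszFactor
  fun_prop

/-- The Gamma integral at `q = |x - y|²` gives a mixture of `exp (-r |x - y|²)`; each of these is
the `u`-integral of a product of two Gaussians, and the constant in `rieszFactor` cancels the
Gaussian normalization. The identity includes the diagonal, where both sides are `∞`. -/
lemma rieszKernel_eq_lintegral {s : ℝ} (hs : 0 < s) (x y : E) :
    ENNReal.ofReal (Real.Gamma (s / 2)) * ‖x - y‖ₑ ^ (-s) =
      ∫⁻ q, rieszFactor s x q * rieszFactor s y q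
        ∂((volume.restrict (Ioi (0 : ℝ))).prod (volume : Measure E)) := by
  have hpow : ‖x - y‖ₑ ^ (-s) = ENNReal.ofReal (‖x - y‖ ^ 2) ^ (-(s / 2)) := by
    rw [ENNReal.ofReal_pow (norm_nonneg _), ofReal_norm, ← ENNReal.rpow_natCast,
      ← ENNReal.rpow_mul]
    congr 1
    push_cast
    ring
  have hm : ∀ z : E, Measurable fun q : ℝ × E => rieszFactor s z q := fun z =>
    (measurable_rieszFactor s).comp measurable_prodMk_left
  have hxy : Measurable fun q : ℝ × E => rieszFactor s x q * rieszFactor s y q :=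
    (hm x).mul (hm y)
  rw [hpow, ← lintegral_rpow_mul_exp_neg (by positivity) (by positivity),
    lintegral_prod _ hxy.aemeasurable]
  refine setLIntegral_congr_fun measurableSet_Ioi fun r hr => ?_
  have hr' : (0 : ℝ) < r := hr
  set d : ℝ := (Module.finrank ℝ E / 2 : ℝ)
  set c : ℝ := (Real.pi / (4 * r)) ^ d with hc
  have hcpos : 0 < c := by have := Real.pi_pos; positivity
  have hpw : 0 ≤ r ^ (s / 2 - 1) / c := by positivity
  have hprod : ∀ u : E, rieszFactor s x (r, u) * rieszFactor s y (r, u) =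
      ENNReal.ofReal (r ^ (s / 2 - 1) / c) * ENNReal.ofReal
        (Real.exp (-(2 * r) * ‖x - u‖ ^ 2) * Real.exp (-(2 * r) * ‖y - u‖ ^ 2)) := by
    intro u
    unfold rieszFactor
    rw [← ENNReal.ofReal_mul (by positivity), ← ENNReal.ofReal_mul (by positivity)]
    congr 1
    change √(r ^ (s / 2 - 1) / c) * _ * (√(r ^ (s / 2 - 1) / c) * _) = _
    rw [mul_mul_mul_comm, Real.mul_self_sqrt hpw]
  simp_rw [hprod]
  rw [lintegral_const_mul' _ _ ENNReal.ofReal_ne_top, lintegral_gaussian_mul_gaussian hr',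
    ← ENNReal.ofReal_mul hpw]
  congr 1
  rw [← hc]
  field_simp

lemma measurable_rieszKernel (s : ℝ) :
    Measurable (Function.uncurry fun x y : E => ‖x - y‖ₑ ^ (-s)) := by
  unfold Function.uncurry
  fun_prop

lemma mutualEnergy_riesz {s : ℝ} (hs : 0 < s) (μ ν : Measure E) [SFinite μ] [SFinite ν] :
    ENNReal.ofReal (Real.Gamma (s / 2)) * mutualEnergy (fun x y : E => ‖x - y‖ₑ ^ (-s)) μ ν =
      ∫⁻ q, (∫⁻ x, rieszFactor s x q ∂μ) * (∫⁻ y, rieszFactor s y q ∂ν)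
        ∂((volume.restrict (Ioi (0 : ℝ))).prod (volume : Measure E)) := by
  have hm := measurable_rieszFactor (E := E) s
  have h1 : Measurable fun p : (E × E) × (ℝ × E) => rieszFactor s p.1.1 p.2 :=
    hm.comp ((measurable_fst.comp measurable_fst).prodMk measurable_snd)
  have h2 : Measurable fun p : (E × E) × (ℝ × E) => rieszFactor s p.1.2 p.2 :=
    hm.comp ((measurable_snd.comp measurable_fst).prodMk measurable_snd)
  have h12 : Measurable fun p : (E × E) × (ℝ × E) =>
      rieszFactor s p.1.1 p.2 * rieszFactor s p.1.2 p.2 := h1.mul h2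
  have h3 : ∀ q : ℝ × E, Measurable fun x : E => rieszFactor s x q := fun q =>
    hm.comp measurable_prodMk_right
  rw [mutualEnergy_eq_lintegral_prod (measurable_rieszKernel s),
    ← lintegral_const_mul' _ _ ENNReal.ofReal_ne_top]
  have h4 : ∀ q : ℝ × E, (∫⁻ x, rieszFactor s x q ∂μ) * (∫⁻ y, rieszFactor s y q ∂ν) =
      ∫⁻ p : E × E, rieszFactor s p.1 q * rieszFactor s p.2 q ∂(μ.prod ν) := fun q =>
    (lintegral_prod_mul (h3 q).aemeasurable (h3 q).aemeasurable).symm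
  simp only [h4, rieszKernel_eq_lintegral hs]
  exact lintegral_lintegral_swap h12.aemeasurable

/-- With truncated subtraction, `(f - g) + (g - f)` plays the role of `|f - g|`, and `f² + g² = 2fg
+ |f - g|²`. Integrating and cancelling the finite `e + e` leaves `∫ |f - g|² = 0`. -/
lemma ae_eq_of_lintegral_mul_self_le {Θ : Type*} [MeasurableSpace Θ] {m : Measure Θ}
    {f g : Θ → ℝ≥0∞} (hf : Measurable f) (hg : Measurable g) {e : ℝ≥0∞} (he : e ≠ ∞)
    (hff : ∫⁻ q, f q * f q ∂m ≤ e) (hgg : ∫⁻ q, g q * g q ∂m ≤ e)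
    (hfg : e ≤ ∫⁻ q, f q * g q ∂m) : f =ᵐ[m] g := by
  have hfin : ∀ {h : Θ → ℝ≥0∞}, Measurable h → ∫⁻ q, h q * h q ∂m ≤ e → ∀ᵐ q ∂m, h q ≠ ∞ := by
    intro h hm hle
    filter_upwards [ae_lt_top (hm.mul hm) (ne_top_of_le_ne_top he hle)] with q hq htop
    simp [htop] at hq
  have hD : Measurable fun q => (f q - g q + (g q - f q)) * (f q - g q + (g q - f q)) := by
    fun_prop
  have hsum : ∫⁻ q, f q * f q ∂m + ∫⁻ q, g q * g q ∂m = (∫⁻ q, f q * g q ∂m +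
      ∫⁻ q, f q * g q ∂m) +
      ∫⁻ q, (f q - g q + (g q - f q)) * (f q - g q + (g q - f q)) ∂m := by
    have hff' : Measurable fun q => f q * f q := hf.mul hf
    have hfg' : Measurable fun q => f q * g q := hf.mul hg
    rw [← lintegral_add_left hff', ← lintegral_add_left hfg', ← lintegral_add_right _ hD]
    refine lintegral_congr_ae ?_
    filter_upwards [hfin hf hff, hfin hg hgg] with q h1 h2
    lift f q to ℝ≥0 using h1 with a
    lift g q to ℝ≥0 using h2 with b
    norm_cast
    rcases le_total a b with h | h
    · obtain ⟨c, rfl⟩ := exists_add_of_le h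
      simp only [add_tsub_cancel_left, tsub_eq_zero_of_le h, zero_add]
      ring
    · obtain ⟨c, rfl⟩ := exists_add_of_le h
      simp only [add_tsub_cancel_left, tsub_eq_zero_of_le h, add_zero]
      ring
  have hzero : ∫⁻ q, (f q - g q + (g q - f q)) * (f q - g q + (g q - f q)) ∂m = 0 := by
    set D := ∫⁻ q, (f q - g q + (g q - f q)) * (f q - g q + (g q - f q)) ∂m
    have h1 : e + e + D ≤ e + e + 0 :=
      calc e + e + D ≤ _ := add_le_add_left (add_le_add hfg hfg) _
        _ = _ := hsum.symm
        _ ≤ e + e := add_le_add hff hgg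
        _ = e + e + 0 := (add_zero _).symm
    exact nonpos_iff_eq_zero.1
      ((ENNReal.add_le_add_iff_left (ENNReal.add_ne_top.2 ⟨he, he⟩)).1 h1)
  rw [lintegral_eq_zero_iff hD] at hzero
  filter_upwards [hzero] with q hq
  have hq' : f q - g q + (g q - f q) = 0 := by simpa using hq
  rw [add_eq_zero] at hq'
  exact le_antisymm (tsub_eq_zero_iff_le.1 hq'.1) (tsub_eq_zero_iff_le.1 hq'.2)

/-- The unnormalized Gaussian measure. -/
noncomputable def gaussianWeight (E : Type*) [NormedAddCommGroup E] [InnerProductSpace ℝ E]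
    [FiniteDimensional ℝ E] [MeasurableSpace E] [BorelSpace E] (b : ℝ) : Measure E :=
  (volume : Measure E).withDensity fun u => ENNReal.ofReal (Real.exp (-b * ‖u‖ ^ 2))

/-- The Fourier transform of a Gaussian is a nonzero constant times an exponential, so convolution
with it can be cancelled on the Fourier side. -/
lemma charFun_gaussianWeight_ne_zero {b : ℝ} (hb : 0 < b) (ξ : E) :
    charFun (gaussianWeight E b) ξ ≠ 0 := by
  have h := GaussianFourier.integral_cexp_neg_mul_sq_norm_add (V := E) (b := (b : ℂ))
    (by simpa using hb) Complex.I ξ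
  have h2 : charFun (gaussianWeight E b) ξ =
      ((Real.pi : ℂ) / b) ^ (Module.finrank ℝ E / 2 : ℂ) *
        Complex.exp (Complex.I ^ 2 * ‖ξ‖ ^ 2 / (4 * b)) := by
    rw [← h, charFun_apply, gaussianWeight, integral_withDensity_eq_integral_toReal_smul
      (by fun_prop) (by simp)]
    refine integral_congr_ae (Eventually.of_forall fun u => ?_)
    simp only [ENNReal.toReal_ofReal (Real.exp_pos _).le, Complex.real_smul, Complex.ofReal_exp]
    rw [← Complex.exp_add, real_inner_comm]
    congr 1
    push_cast
    ring
  rw [h2]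
  refine mul_ne_zero ?_ (Complex.exp_ne_zero _)
  rw [Complex.cpow_def_of_ne_zero]
  · exact Complex.exp_ne_zero _
  · have : (b : ℂ) ≠ 0 := by exact_mod_cast hb.ne'
    have hpi : (Real.pi : ℂ) ≠ 0 := by exact_mod_cast Real.pi_ne_zero
    exact div_ne_zero hpi this

lemma conv_gaussianWeight (μ : Measure E) [SFinite μ] (b : ℝ) :
    μ ∗ gaussianWeight E b = (volume : Measure E).withDensity
      fun u => ∫⁻ x, ENNReal.ofReal (Real.exp (-b * ‖x - u‖ ^ 2)) ∂μ := by
  have : SFinite (gaussianWeight E b) := by unfold gaussianWeight; infer_instance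
  ext S hS
  have hind : Measurable (S.indicator (1 : E → ℝ≥0∞)) := measurable_const.indicator hS
  rw [← lintegral_indicator_one hS, Measure.lintegral_conv hind, withDensity_apply _ hS,
    ← lintegral_indicator hS]
  have h1 : ∀ x : E, ∫⁻ y, S.indicator (1 : E → ℝ≥0∞) (x + y) ∂(gaussianWeight E b) =
      ∫⁻ u, S.indicator (1 : E → ℝ≥0∞) u *
        ENNReal.ofReal (Real.exp (-b * ‖x - u‖ ^ 2)) := by
    intro x
    rw [gaussianWeight, lintegral_withDensity_eq_lintegral_mul _ (by fun_prop)
      (by exact hind.comp (measurable_const_add x)), 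
      ← lintegral_add_left_eq_self (fun u => S.indicator (1 : E → ℝ≥0∞) u *
        ENNReal.ofReal (Real.exp (-b * ‖x - u‖ ^ 2))) x]
    refine lintegral_congr fun u => ?_
    simp only [Pi.mul_apply, sub_add_cancel_left, norm_neg]
    rw [mul_comm]
  have hmeas : Measurable fun p : E × E => S.indicator (1 : E → ℝ≥0∞) p.2 *
      ENNReal.ofReal (Real.exp (-b * ‖p.1 - p.2‖ ^ 2)) := by
    have : Measurable fun p : E × E => S.indicator (1 : E → ℝ≥0∞) p.2 := hind.comp measurable_snd
    have h2 : Measurable fun p : E × E => ENNReal.ofReal (Real.exp (-b * ‖p.1 - p.2‖ ^ 2)) := by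
      fun_prop
    exact this.mul h2
  simp_rw [h1]
  rw [lintegral_lintegral_swap hmeas.aemeasurable]
  refine lintegral_congr fun u => ?_
  by_cases hu : u ∈ S <;> simp [hu]

/-- A finite measure is determined by its Gaussian convolution. -/
lemma eq_of_gaussian_potential_ae_eq {μ ν : Measure E} [IsFiniteMeasure μ] [IsFiniteMeasure ν]
    {b : ℝ} (hb : 0 < b)
    (h : (fun u : E => ∫⁻ x, ENNReal.ofReal (Real.exp (-b * ‖x - u‖ ^ 2)) ∂μ) =ᵐ[volume]
      fun u : E => ∫⁻ x, ENNReal.ofReal (Real.exp (-b * ‖x - u‖ ^ 2)) ∂ν) : μ = ν := by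
  have hconv : μ ∗ gaussianWeight E b = ν ∗ gaussianWeight E b := by
    rw [conv_gaussianWeight, conv_gaussianWeight, withDensity_congr_ae h]
  have : IsFiniteMeasure (gaussianWeight E b) := by
    refine isFiniteMeasure_withDensity ?_
    rw [lintegral_exp_neg_mul_sq_norm E hb]
    exact ENNReal.ofReal_ne_top
  refine Measure.ext_of_charFun (funext fun ξ => ?_)
  have h2 := congrArg (fun ρ => charFun ρ ξ) hconv
  simp only [charFun_conv] at h2
  exact mul_right_cancel₀ (charFun_gaussianWeight_ne_zero hb ξ) h2

/-- Strict positive definiteness of the Riesz kernel. -/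
theorem eq_of_rieszEnergy_le {s : ℝ} (hs : 0 < s) {μ ν : Measure E} [IsFiniteMeasure μ]
    [IsFiniteMeasure ν] {e : ℝ≥0∞} (he : e ≠ ∞)
    (hμ : mutualEnergy (fun x y : E => ‖x - y‖ₑ ^ (-s)) μ μ ≤ e)
    (hν : mutualEnergy (fun x y : E => ‖x - y‖ₑ ^ (-s)) ν ν ≤ e)
    (hμν : e ≤ mutualEnergy (fun x y : E => ‖x - y‖ₑ ^ (-s)) μ ν) : μ = ν := by
  have hm := measurable_rieszFactor (E := E) s
  have hmeas : ∀ ρ : Measure E, SFinite ρ → Measurable fun q => ∫⁻ x, rieszFactor s x q ∂ρ :=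
    fun ρ _ => hm.lintegral_prod_left'
  have hae := ae_eq_of_lintegral_mul_self_le
    (m := (volume.restrict (Ioi (0 : ℝ))).prod (volume : Measure E))
    (hmeas μ inferInstance) (hmeas ν inferInstance)
    (e := ENNReal.ofReal (Real.Gamma (s / 2)) * e)
    (ENNReal.mul_ne_top ENNReal.ofReal_ne_top he)
    (by rw [← mutualEnergy_riesz hs]; gcongr) (by rw [← mutualEnergy_riesz hs]; gcongr)
    (by rw [← mutualEnergy_riesz hs]; gcongr)
  have hae2 := Measure.ae_ae_of_ae_prod hae
  have hne : (ae (volume.restrict (Ioi (0 : ℝ)))).NeBot := by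
    rw [ae_neBot, Ne, Measure.restrict_eq_zero]
    simp
  -- The potentials agree for almost every `(r, u)`; a single scale `r` is enough to recover the
  -- measure.
  obtain ⟨r, hr, hrpos⟩ := (hae2.and (ae_restrict_mem measurableSet_Ioi)).exists
  have hr' : (0 : ℝ) < r := hrpos
  refine eq_of_gaussian_potential_ae_eq (b := 2 * r) (by positivity) ?_
  filter_upwards [hr] with u hu
  have hpi := Real.pi_pos
  have hc : 0 < √(r ^ (s / 2 - 1) / (Real.pi / (4 * r)) ^ (Module.finrank ℝ E / 2 : ℝ)) := by
    positivity
  simp only [rieszFactor, ENNReal.ofReal_mul hc.le] at hu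
  rw [lintegral_const_mul' _ _ ENNReal.ofReal_ne_top,
    lintegral_const_mul' _ _ ENNReal.ofReal_ne_top] at hu
  exact (ENNReal.mul_right_inj (by simpa using hc) ENNReal.ofReal_ne_top).1 hu

end Euclidean

/-! ### Hausdorff content and a measure of finite Riesz energy -/

/-- The Hausdorff content of dimension `t`. -/
noncomputable def content {X : Type*} [PseudoEMetricSpace X] (t : ℝ) : OuterMeasure X :=
  OuterMeasure.boundedBy fun S => Metric.ediam S ^ t

lemma content_le_ediam {X : Type*} [PseudoEMetricSpace X] (t : ℝ) (S : Set X) :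
    content t S ≤ Metric.ediam S ^ t := OuterMeasure.boundedBy_le _

/-- A cover with total `∑ diam ^ t` below `r ^ t` has every diameter at most `r`, so covers
witnessing zero content automatically meet the mesh restriction in the Hausdorff measure. -/
lemma hausdorffMeasure_eq_zero_of_content {X : Type*} [EMetricSpace X] [MeasurableSpace X]
    [BorelSpace X] {t : ℝ} (ht : 0 < t) {A : Set X} (h : content t A = 0) :
    Measure.hausdorffMeasure t A = 0 := by
  rw [content, OuterMeasure.boundedBy_apply] at h
  rw [← nonpos_iff_eq_zero, Measure.hausdorffMeasure_apply]
  refine iSup₂_le fun r hr => ?_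
  refine le_of_forall_gt fun ε hε => ?_
  have hrt : 0 < min ε (r ^ t) :=
    lt_min hε (pos_iff_ne_zero.2 (by simp [ENNReal.rpow_eq_zero_iff, hr.ne', ht.not_gt]))
  rw [← h, iInf_lt_iff] at hrt
  obtain ⟨U, hU⟩ := hrt
  rw [iInf_lt_iff] at hU
  obtain ⟨hAU, hU⟩ := hU
  refine lt_of_le_of_lt (iInf₂_le_of_le U hAU (iInf_le_of_le (fun n => ?_) le_rfl))
    (lt_of_lt_of_le hU (min_le_left _ _))
  rcases (U n).eq_empty_or_nonempty with he | hne
  · simp [he]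
  have h1 : Metric.ediam (U n) ^ t ≤ r ^ t := by
    calc Metric.ediam (U n) ^ t = ⨆ _ : (U n).Nonempty, Metric.ediam (U n) ^ t := by simp [hne]
      _ ≤ ∑' n, ⨆ _ : (U n).Nonempty, Metric.ediam (U n) ^ t :=
        ENNReal.le_tsum (f := fun n => ⨆ _ : (U n).Nonempty, Metric.ediam (U n) ^ t) n
      _ ≤ r ^ t := (hU.trans_le (min_le_right _ _)).le
  exact (ENNReal.rpow_le_rpow_iff ht).1 h1

/-- The constant in the estimate of a Riesz potential by the growth of the measure of balls. -/
noncomputable def dyadicConst (t t' D : ℝ) : ℝ≥0∞ :=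
  ∑' k : ℕ, ENNReal.ofReal ((D / 2 ^ (k + 1)) ^ (-t)) * ENNReal.ofReal ((D / 2 ^ k) ^ t')

lemma dyadicConst_ne_top {t t' D : ℝ} (htt' : t < t') (hD : 0 < D) :
    dyadicConst t t' D ≠ ∞ := by
  have h : ∀ k : ℕ, ENNReal.ofReal ((D / 2 ^ (k + 1)) ^ (-t)) * ENNReal.ofReal ((D / 2 ^ k) ^ t') =
      ENNReal.ofReal (D ^ (t' - t) * 2 ^ t * ((2 : ℝ) ^ (t - t')) ^ k) := by
    intro k
    rw [← ENNReal.ofReal_mul (by positivity)]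
    congr 1
    rw [Real.div_rpow hD.le (by positivity), Real.div_rpow hD.le (by positivity),
      ← Real.rpow_natCast, ← Real.rpow_natCast, ← Real.rpow_natCast,
      ← Real.rpow_mul two_pos.le, ← Real.rpow_mul two_pos.le, ← Real.rpow_mul two_pos.le,
      div_mul_div_comm, ← Real.rpow_add hD, ← Real.rpow_add two_pos, mul_assoc,
      ← Real.rpow_add two_pos, div_eq_mul_inv, ← Real.rpow_neg two_pos.le]
    congr 2
    · ring
    · push_cast
      ring
  unfold dyadicConst
  simp_rw [h]
  -- A geometric series of ratio `2 ^ (t - t')`, which is less than 1 because `t < t'`.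
  have hsum : Summable fun k : ℕ => D ^ (t' - t) * 2 ^ t * ((2 : ℝ) ^ (t - t')) ^ k :=
    (summable_geometric_of_lt_one (by positivity)
      (Real.rpow_lt_one_of_one_lt_of_neg one_lt_two (by linarith))).mul_left _
  exact hsum.tsum_ofReal_ne_top

/-- Off the diagonal, the single term with `D / 2 ^ (k + 1) < dist z w ≤ D / 2 ^ k` already
suffices; on it the right side diverges, since `t > 0` keeps its terms bounded below. -/
lemma edist_rpow_neg_le_tsum {X : Type*} [MetricSpace X] {t D : ℝ} (ht : 0 < t) (hD : 0 < D) {z w : X}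
    (hw : w ∈ Metric.closedBall z D) :
    edist z w ^ (-t) ≤ ∑' k : ℕ, ENNReal.ofReal ((D / 2 ^ (k + 1)) ^ (-t)) *
      (Metric.closedBall z (D / 2 ^ k)).indicator 1 w := by
  rcases eq_or_ne z w with rfl | hne
  · have h1 : ∀ k : ℕ, ENNReal.ofReal (D ^ (-t)) ≤ ENNReal.ofReal ((D / 2 ^ (k + 1)) ^ (-t)) *
        (Metric.closedBall z (D / 2 ^ k)).indicator 1 z := by
      intro k
      rw [indicator_of_mem (Metric.mem_closedBall_self (by positivity)), Pi.one_apply, mul_one]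
      refine ENNReal.ofReal_le_ofReal ?_
      refine Real.rpow_le_rpow_of_nonpos (by positivity) ?_ (by linarith)
      exact div_le_self hD.le (one_le_pow₀ one_le_two)
    have h2 : ∑' _ : ℕ, ENNReal.ofReal (D ^ (-t)) = ∞ :=
      ENNReal.tsum_const_eq_top_of_ne_zero (by simpa using Real.rpow_pos_of_pos hD _)
    refine le_trans le_top (le_trans h2.ge (ENNReal.tsum_le_tsum h1))
  · have hd : 0 < dist z w := dist_pos.2 hne
    have hwD : dist z w ≤ D := by rw [dist_comm]; exact hw
    obtain ⟨k, hk1, hk2⟩ := exists_nat_pow_near (x := D / dist z w) (y := 2)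
      ((one_le_div hd).2 hwD) one_lt_two
    have hmem : w ∈ Metric.closedBall z (D / 2 ^ k) := by
      rw [Metric.mem_closedBall, dist_comm, le_div_iff₀ (by positivity), mul_comm]
      exact (le_div_iff₀ hd).1 hk1
    refine le_trans ?_ (ENNReal.le_tsum k)
    rw [indicator_of_mem hmem, Pi.one_apply, mul_one, edist_dist, ENNReal.ofReal_rpow_of_pos hd]
    refine ENNReal.ofReal_le_ofReal ?_
    refine Real.rpow_le_rpow_of_nonpos (by positivity) ?_ (by linarith)
    rw [div_le_iff₀ (by positivity), mul_comm]
    exact ((div_lt_iff₀ hd).1 hk2).le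

section Metric

variable {X : Type*} [MetricSpace X] [MeasurableSpace X] [BorelSpace X]

lemma lintegral_edist_rpow_neg_le {t t' D : ℝ} (ht : 0 < t) (hD : 0 < D) {μ : Measure X}
    {z : X} (hμ : ∀ᵐ w ∂μ, w ∈ Metric.closedBall z D) {M : ℝ≥0∞}
    (hM : ∀ r : ℝ, 0 < r → r ≤ D → μ (Metric.closedBall z r) ≤ M * ENNReal.ofReal (r ^ t')) :
    ∫⁻ w, edist z w ^ (-t) ∂μ ≤ M * dyadicConst t t' D := by
  calc ∫⁻ w, edist z w ^ (-t) ∂μ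
      ≤ ∫⁻ w, ∑' k : ℕ, ENNReal.ofReal ((D / 2 ^ (k + 1)) ^ (-t)) *
        (Metric.closedBall z (D / 2 ^ k)).indicator 1 w ∂μ := by
        refine lintegral_mono_ae ?_
        filter_upwards [hμ] with w hw
        exact edist_rpow_neg_le_tsum ht hD hw
    _ = ∑' k : ℕ, ENNReal.ofReal ((D / 2 ^ (k + 1)) ^ (-t)) *
        μ (Metric.closedBall z (D / 2 ^ k)) := by
        have hmeas : ∀ k : ℕ, Measurable
            ((Metric.closedBall z (D / 2 ^ k)).indicator (1 : X → ℝ≥0∞)) := fun k =>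
          measurable_const.indicator Metric.isClosed_closedBall.measurableSet
        rw [lintegral_tsum fun k => ((hmeas k).const_mul _).aemeasurable]
        refine tsum_congr fun k => ?_
        rw [lintegral_const_mul _ (hmeas k),
          lintegral_indicator_one Metric.isClosed_closedBall.measurableSet]
    _ ≤ ∑' k : ℕ, M * (ENNReal.ofReal ((D / 2 ^ (k + 1)) ^ (-t)) *
        ENNReal.ofReal ((D / 2 ^ k) ^ t')) := by
        refine ENNReal.tsum_le_tsum fun k => ?_
        rw [mul_left_comm]
        gcongr
        exact hM _ (by positivity) (div_le_self hD.le (one_le_pow₀ one_le_two))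
    _ = M * dyadicConst t t' D := ENNReal.tsum_mul_left

/-- If every point of a bounded set carries a ball of mass at least `M r ^ t`, then the
Hausdorff content of the set is at most of order `M⁻¹`. -/
lemma content_mul_le [SecondCountableTopology X] {t D : ℝ} (ht : 0 < t) {μ : Measure X}
    [IsProbabilityMeasure μ] {A : Set X} {M : ℝ≥0∞}
    (h : ∀ z ∈ A, ∃ r : ℝ, 0 < r ∧ r ≤ D ∧
      M * ENNReal.ofReal (r ^ t) ≤ μ (Metric.closedBall z r)) :
    M * content t A ≤ ENNReal.ofReal (8 ^ t) := by
  choose! r hr0 hrD hrM using h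
  -- Vitali with enlargement factor 4: the enlarged balls have diameter at most `8 r`, which is the
  -- source of `8 ^ t`, while the disjoint original balls have total mass at most 1.
  obtain ⟨u, huA, hdisj, hcov⟩ := Vitali.exists_disjoint_subfamily_covering_enlargement_closedBall
    A id r D hrD 4 (by norm_num)
  simp only [id] at hdisj hcov
  have hu : u.Countable := hdisj.countable_of_nonempty_interior fun z hz =>
    ⟨z, Metric.ball_subset_interior_closedBall (Metric.mem_ball_self (hr0 z (huA hz)))⟩
  have hAu : A ⊆ ⋃ z ∈ u, Metric.closedBall z (4 * r z) := by
    intro z hz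
    obtain ⟨b, hb, hsub⟩ := hcov z hz
    exact mem_iUnion₂.2 ⟨b, hb, hsub (Metric.mem_closedBall_self (hr0 z hz).le)⟩
  have := hu.to_subtype
  have hball : ∀ z : u, M * content t (Metric.closedBall (z : X) (4 * r z)) ≤
      ENNReal.ofReal (8 ^ t) * μ (Metric.closedBall (z : X) (r z)) := by
    intro z
    have hz := hr0 z (huA z.2)
    calc M * content t (Metric.closedBall (z : X) (4 * r z))
        ≤ M * ENNReal.ofReal ((8 * r z) ^ t) := by
          gcongr
          refine (content_le_ediam t _).trans ?_
          rw [← ENNReal.ofReal_rpow_of_pos (by positivity)]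
          refine ENNReal.rpow_le_rpow ?_ ht.le
          refine Metric.ediam_le_of_forall_dist_le fun x hx y hy => ?_
          rw [Metric.mem_closedBall] at hx hy
          linarith [dist_triangle_right x y (z : X)]
      _ = ENNReal.ofReal (8 ^ t) * (M * ENNReal.ofReal (r z ^ t)) := by
          rw [Real.mul_rpow (by norm_num) hz.le, ENNReal.ofReal_mul (by positivity)]
          ring
      _ ≤ _ := by gcongr; exact hrM z (huA z.2)
  calc M * content t A ≤ M * ∑' z : u, content t (Metric.closedBall (z : X) (4 * r z)) := by
        gcongr
        refine (measure_mono hAu).trans ?_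
        rw [biUnion_eq_iUnion]
        exact measure_iUnion_le _
    _ = ∑' z : u, M * content t (Metric.closedBall (z : X) (4 * r z)) := ENNReal.tsum_mul_left.symm
    _ ≤ ∑' z : u, ENNReal.ofReal (8 ^ t) * μ (Metric.closedBall (z : X) (r z)) :=
        ENNReal.tsum_le_tsum hball
    _ = ENNReal.ofReal (8 ^ t) * ∑' z : u, μ (Metric.closedBall (z : X) (r z)) :=
        ENNReal.tsum_mul_left
    _ ≤ ENNReal.ofReal (8 ^ t) * 1 := by
        gcongr
        rw [← measure_biUnion hu hdisj fun z _ => Metric.isClosed_closedBall.measurableSet]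
        exact prob_le_one
    _ = _ := mul_one _

end Metric

/-- The potential of an equilibrium measure of a bounded kernel is at least the energy,
everywhere on the set. -/
lemma IsEquilibrium.energy_le_potential {A : Set ℂ} (hA : MeasurableSet A) {K : ℂ → ℂ → ℝ≥0∞}
    (hK : Measurable (Function.uncurry K)) (hsymm : ∀ x y, K x y = K y x) {n : ℝ≥0∞} (hn : n ≠ ∞)
    (hKn : ∀ x y, K x y ≤ n) {μ : ProbabilityMeasure ℂ} (hμ : IsEquilibrium A K μ) {z : ℂ}
    (hz : z ∈ A) : energy K μ ≤ ∫⁻ w, K w z ∂(μ : Measure ℂ) := by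
  let δz : ProbabilityMeasure ℂ := ⟨Measure.dirac z, inferInstance⟩
  have hδz : δz ∈ measuresOn A := by
    change Measure.dirac z Aᶜ = 0
    simp [Measure.dirac_apply' _ hA.compl, hz]
  have hmeas : ∀ ρ : ProbabilityMeasure ℂ, Measurable fun w => ∫⁻ z, K z w ∂(ρ : Measure ℂ) :=
    fun ρ => by exact (hK.comp measurable_swap).lintegral_prod_right'
  have hB : mutualEnergy K (μ : Measure ℂ) (δz : Measure ℂ) = ∫⁻ w, K w z ∂(μ : Measure ℂ) :=
    lintegral_dirac' z (hmeas μ)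
  have hint : ∀ w, ∫⁻ z, K z w ∂(μ : Measure ℂ) ≤ n := fun w =>
    (lintegral_mono fun z => hKn z w).trans (by simp)
  have hEfin : energy K μ ≠ ∞ := ne_top_of_le_ne_top hn
    ((lintegral_mono hint).trans (by simp))
  have hBfin : ∫⁻ w, K w z ∂(μ : Measure ℂ) ≠ ∞ := ne_top_of_le_ne_top hn (hint z)
  have hkfin : energy K δz ≠ ∞ := by
    refine ne_top_of_le_ne_top hn ((lintegral_mono fun w => ?_ : energy K δz ≤ _).trans
      (lintegral_const n).le |>.trans (by simp))
    exact (lintegral_mono fun z => hKn z w).trans (by simp)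
  have hmin : ∀ a b : ℝ≥0, a + b = 1 → energy K μ ≤ (a * a : ℝ≥0) * energy K μ +
      (2 * (a * b) : ℝ≥0) * ∫⁻ w, K w z ∂(μ : Measure ℂ) + (b * b : ℝ≥0) * energy K δz := by
    intro a b hab
    have hab' : (a : ℝ≥0∞) + b = 1 := by exact_mod_cast hab
    have := hμ.2 _ (mix_mem_measuresOn hab' hμ.1 hδz)
    rw [energy_mix hK hsymm, hB] at this
    push_cast
    rwa [mul_assoc 2]
  lift energy K μ to ℝ≥0 using hEfin with e
  lift energy K δz to ℝ≥0 using hkfin with k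
  lift ∫⁻ w, K w z ∂(μ : Measure ℂ) to ℝ≥0 using hBfin with b
  by_contra! hlt
  have hlt' : b < e := by exact_mod_cast hlt
  have hlt2 : (b : ℝ) < e := by exact_mod_cast hlt'
  -- If the potential `b` at `z` were below the energy `e`, moving mass `x` to `z` would change the
  -- energy by `-2x(e - b)` to first order. This `x` is small enough for that gain to beat the
  -- quadratic terms, including the energy `k` of the point mass.
  set x : ℝ := (e - b) / (e + k + (e - b)) with hx
  have hden : 0 < (e : ℝ) + k + (e - b) := by
    linarith [e.coe_nonneg, k.coe_nonneg]
  have hx0 : 0 < x := div_pos (by linarith) hden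
  have hx1 : x ≤ 1 := by
    rw [hx, div_le_one hden]; linarith [e.coe_nonneg, k.coe_nonneg]
  have hxe : x * (e + k + (e - b)) = e - b := div_mul_cancel₀ _ hden.ne'
  have h := hmin ⟨1 - x, by linarith⟩ ⟨x, hx0.le⟩ (Subtype.ext (show 1 - x + x = (1 : ℝ) by ring))
  have h2 : (e : ℝ) ≤ (1 - x) * (1 - x) * e + 2 * ((1 - x) * x) * b + x * x * k := by
    have h3 := (show e ≤ _ by exact_mod_cast h)
    have h4 := NNReal.coe_le_coe.2 h3
    push_cast at h4
    exact h4
  have h5 : x * (2 * (e - b)) ≤ x * (x * (e + k + (e - b)) - x * b) := by nlinarith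
  have h6 := le_of_mul_le_mul_left h5 hx0
  rw [hxe] at h6
  have : 0 ≤ x * b := mul_nonneg hx0.le b.coe_nonneg
  linarith

lemma energy_eq_iSup_min {K : ℂ → ℂ → ℝ≥0∞} (hK : Measurable (Function.uncurry K))
    (μ : ProbabilityMeasure ℂ) :
    energy K μ = ⨆ n : ℕ, energy (fun z w => min (K z w) n) μ := by
  have hKn : ∀ n : ℕ, Measurable (Function.uncurry fun z w => min (K z w) (n : ℝ≥0∞)) :=
    fun n => hK.min measurable_const
  simp_rw [energy_eq_mutualEnergy]
  rw [mutualEnergy_eq_lintegral_prod hK]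
  simp_rw [fun n => mutualEnergy_eq_lintegral_prod (hKn n)]
  have hm : ∀ n : ℕ, Measurable fun p : ℂ × ℂ => min (K p.1 p.2) (n : ℝ≥0∞) := hKn
  rw [← lintegral_iSup hm fun n m hnm p => min_le_min le_rfl (by exact_mod_cast hnm)]
  simp_rw [iSup_min_natCast]

/-- A compact set of positive `t'`-content carries a probability measure of finite Riesz
`t`-energy whenever `0 < t < t'`. -/
theorem exists_rieszEnergy_ne_top {A : Set ℂ} (hA : IsCompact A) {t t' : ℝ} (ht : 0 < t)
    (htt' : t < t') (hcont : content t' A ≠ 0) :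
    ∃ μ ∈ measuresOn A, energy (fun z w => ‖z - w‖ₑ ^ (-t)) μ ≠ ∞ := by
  have hne : A.Nonempty := by
    by_contra h
    rw [not_nonempty_iff_eq_empty] at h
    exact hcont (by rw [h]; exact measure_empty)
  have hKc : Continuous (Function.uncurry fun z w : ℂ => ‖z - w‖ₑ ^ (-t)) :=
    ENNReal.continuous_rpow_const.comp (continuous_fst.sub continuous_snd).enorm
  let k : ℕ → ℂ → ℂ → ℝ≥0∞ := fun n z w => min (‖z - w‖ₑ ^ (-t)) n
  have hkc : ∀ n, Continuous (Function.uncurry (k n)) := fun n => hKc.min continuous_const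
  have hsymm : ∀ n z w, k n z w = k n w z := fun n z w => by
    simp only [k, ← neg_sub w z, enorm_neg]
  set D : ℝ := Metric.diam A + 1 with hDdef
  have hD : 0 < D := by have := Metric.diam_nonneg (s := A); linarith
  have hAD : ∀ z ∈ A, A ⊆ Metric.closedBall z D := fun z hz w hw => by
    have := Metric.dist_le_diam_of_mem hA.isBounded hw hz
    rw [Metric.mem_closedBall]; linarith
  have hex : ∀ n, ∃ μ, IsEquilibrium A (k n) μ := fun n => by
    obtain ⟨μ, hμ, hmin⟩ := ((lowerSemicontinuous_energy (hkc n)).lowerSemicontinuousOn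
      (measuresOn A)).exists_isMinOn (measuresOn_nonempty hA.isClosed hne)
      (isCompact_measuresOn hA)
    exact ⟨μ, hμ, isMinOn_iff.1 hmin⟩
  choose μ hμ using hex
  have hS := dyadicConst_ne_top htt' hD
  -- Any finite `M` with `8 ^ t' < M * content t' A` would do; the minimum with 1 makes the inverse
  -- cancel even if the content is infinite.
  set M : ℝ≥0∞ := (ENNReal.ofReal (8 ^ t') + 1) * (min (content t' A) 1)⁻¹ with hMdef
  have hmin0 : min (content t' A) 1 ≠ 0 := by
    rw [Ne, min_eq_iff]; simp [hcont]
  have hmintop : min (content t' A) 1 ≠ ∞ := ne_top_of_le_ne_top ENNReal.one_ne_top (min_le_right _ _)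
  have hM : M ≠ ∞ := ENNReal.mul_ne_top (by finiteness) (ENNReal.inv_ne_top.2 hmin0)
  have hMcont : ENNReal.ofReal (8 ^ t') < M * content t' A := by
    calc ENNReal.ofReal (8 ^ t') < ENNReal.ofReal (8 ^ t') + 1 :=
          ENNReal.lt_add_right ENNReal.ofReal_ne_top one_ne_zero
      _ = M * min (content t' A) 1 := by
          rw [hMdef, mul_assoc, ENNReal.inv_mul_cancel hmin0 hmintop, mul_one]
      _ ≤ M * content t' A := by gcongr; exact min_le_left _ _
  have hbound : ∀ n, energy (k n) (μ n) ≤ M * dyadicConst t t' D := by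
    intro n
    by_contra! hlt
    refine absurd (content_mul_le (D := D) (ht.trans htt') (μ := (μ n : Measure ℂ)) (A := A)
      (M := M) fun z hz => ?_) hMcont.not_ge
    by_contra! hcon
    have h1 := lintegral_edist_rpow_neg_le (t' := t') ht hD (μ := (μ n : Measure ℂ)) (z := z)
      (by
        have h0 : (μ n : Measure ℂ) Aᶜ = 0 := (hμ n).1
        filter_upwards [mem_ae_iff.2 h0] with w hw using hAD z hz hw)
      (M := M) (fun r hr hrD => (hcon r hr hrD).le)
    refine absurd (hlt.trans_le ((hμ n).energy_le_potential hA.measurableSet (hkc n).measurable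
      (hsymm n) (ENNReal.natCast_ne_top n) (fun x y => min_le_right _ _) hz)) ?_
    rw [not_lt]
    refine le_trans (lintegral_mono fun w => ?_) h1
    rw [edist_comm, edist_eq_enorm_sub]
    exact min_le_left _ _
  have hcompact := isCompact_measuresOn hA
  -- The sublevel sets of the truncated energies are nested, compact and nonempty. A common point
  -- has all truncated energies bounded uniformly, hence finite full energy by monotone convergence.
  obtain ⟨ν, hν⟩ := IsCompact.nonempty_iInter_of_sequence_nonempty_isCompact_isClosed
    (fun n => measuresOn A ∩ energy (k n) ⁻¹' Iic (M * dyadicConst t t' D))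
    (fun n ρ hρ => ⟨hρ.1, le_trans (lintegral_mono fun w => lintegral_mono fun z =>
      min_le_min le_rfl (by exact_mod_cast n.le_succ)) (hρ.2 : energy (k (n + 1)) ρ ≤ _)⟩)
    (fun n => ⟨μ n, (hμ n).1, hbound n⟩)
    (hcompact.inter_right ((lowerSemicontinuous_energy (hkc 0)).isClosed_preimage _))
    (fun n => hcompact.isClosed.inter
      ((lowerSemicontinuous_energy (hkc n)).isClosed_preimage _))
  rw [mem_iInter] at hν
  refine ⟨ν, (hν 0).1, ne_top_of_le_ne_top (ENNReal.mul_ne_top hM hS) ?_⟩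
  rw [energy_eq_iSup_min hKc.measurable]
  exact iSup_le fun n => (hν n).2

/-! ### Rotation geometry and the kernels as integrals over arc length -/

/-- The power `q ^ (-s / 2)` with values in `[0, ∞]`. -/
noncomputable def negPow (s q : ℝ) : ℝ≥0∞ := ENNReal.ofReal q ^ (-(s / 2))

lemma continuous_negPow (s : ℝ) : Continuous (negPow s) :=
  ENNReal.continuous_rpow_const.comp ENNReal.continuous_ofReal

lemma negPow_le_negPow {s : ℝ} (hs : 0 ≤ s) {p q : ℝ} (h : p ≤ q) : negPow s q ≤ negPow s p := by
  unfold negPow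
  rw [ENNReal.rpow_neg, ENNReal.rpow_neg, ENNReal.inv_le_inv]
  exact ENNReal.rpow_le_rpow (ENNReal.ofReal_le_ofReal h) (by positivity)

lemma negPow_sq_mul (s : ℝ) {c : ℝ} (hc : 0 < c) (q : ℝ) :
    negPow s (c ^ 2 * q) = ENNReal.ofReal (c ^ (-s)) * negPow s q := by
  unfold negPow
  rw [ENNReal.ofReal_mul (by positivity),
    ENNReal.mul_rpow_of_ne_top ENNReal.ofReal_ne_top ENNReal.ofReal_ne_top,
    ENNReal.ofReal_rpow_of_pos (by positivity), ← Real.rpow_natCast, ← Real.rpow_mul hc.le]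
  congr 3
  push_cast
  ring

lemma enorm_rpow_neg {E : Type*} [NormedAddCommGroup E] (s : ℝ) (v : E) :
    ‖v‖ₑ ^ (-s) = negPow s (‖v‖ ^ 2) := by
  rw [negPow, ENNReal.ofReal_pow (norm_nonneg _), ofReal_norm, ← ENNReal.rpow_natCast,
    ← ENNReal.rpow_mul]
  congr 1
  push_cast
  ring

/-- Only the difference of the angles enters, which makes the average over one angle independent of
the other. The `sin²` form also displays the small-angle limit `|z - w|² + u²`. -/
lemma norm_rot_sub_rot_sq (φ ψ : ℝ) (z w : ℂ) :
    ‖rot φ (embed z) - rot ψ (embed w)‖ ^ 2 =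
      ‖z - w‖ ^ 2 + 4 * (z.re * w.re) * Real.sin ((φ - ψ) / 2) ^ 2 := by
  have h1 : Real.sin ((φ - ψ) / 2) ^ 2 = (1 - Real.cos (φ - ψ)) / 2 := by
    have := Real.cos_sq ((φ - ψ) / 2)
    rw [mul_div_cancel₀ _ two_ne_zero] at this
    rw [Real.sin_sq, this]; ring
  rw [EuclideanSpace.norm_sq_eq, Fin.sum_univ_three, h1, Real.cos_sub, Complex.sq_norm,
    Complex.normSq_apply]
  simp [rot, embed]
  linear_combination z.re ^ 2 * (Real.sin_sq_add_cos_sq φ) + w.re ^ 2 * (Real.sin_sq_add_cos_sq ψ)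

lemma rot_zero (p : EuclideanSpace ℝ (Fin 3)) : rot 0 p = p := by
  ext i
  fin_cases i <;> simp [rot]

lemma setLIntegral_Ico_eq_of_periodic {f : ℝ → ℝ≥0∞} {T : ℝ} (hT : 0 < T)
    (hf : Function.Periodic f T) (a b : ℝ) :
    ∫⁻ x in Ico a (a + T), f x = ∫⁻ x in Ioc b (b + T), f x := by
  rw [setLIntegral_congr Ico_ae_eq_Ioc]
  refine (isAddFundamentalDomain_Ioc hT a).setLIntegral_eq (isAddFundamentalDomain_Ioc hT b) f ?_
  rintro ⟨g, hg⟩ x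
  obtain ⟨n, rfl⟩ := AddSubgroup.mem_zmultiples_iff.1 hg
  change f (n • T + x) = f x
  rw [add_comm]
  exact hf.zsmul n x

lemma periodic_negPow_sin (s p q : ℝ) :
    Function.Periodic (fun φ : ℝ => negPow s (p + q * Real.sin (φ / 2) ^ 2)) (2 * Real.pi) := by
  intro φ
  simp only
  rw [add_div, mul_div_cancel_left₀ _ two_ne_zero, Real.sin_add_pi, neg_sq]

lemma lintegral_rot_sub_rot (s ψ : ℝ) (z w : ℂ) :
    ENNReal.ofReal (1 / (2 * Real.pi)) * ∫⁻ φ in Ico (0 : ℝ) (2 * Real.pi),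
      ‖rot φ (embed z) - rot ψ (embed w)‖ₑ ^ (-s) = kernel s z w := by
  have h2pi : (0 : ℝ) < 2 * Real.pi := by positivity
  have h0 : ∀ ψ : ℝ, ∫⁻ φ in Ico (0 : ℝ) (2 * Real.pi),
      ‖rot φ (embed z) - rot ψ (embed w)‖ₑ ^ (-s) = ∫⁻ φ in Ico (0 : ℝ) (2 * Real.pi),
        negPow s (‖z - w‖ ^ 2 + 4 * (z.re * w.re) * Real.sin (φ / 2) ^ 2) := by
    intro ψ
    simp_rw [enorm_rpow_neg, norm_rot_sub_rot_sq]
    have hper := periodic_negPow_sin s (‖z - w‖ ^ 2) (4 * (z.re * w.re))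
    have h1 := setLIntegral_Ico_eq_of_periodic h2pi hper 0 (-ψ)
    have h2 := setLIntegral_Ico_eq_of_periodic h2pi hper (-ψ) (-ψ)
    rw [zero_add] at h1
    rw [h1, ← h2]
    have hpre : Ico (0 : ℝ) (2 * Real.pi) = (fun x => x - ψ) ⁻¹' Ico (-ψ) (-ψ + 2 * Real.pi) := by
      ext x
      simp only [mem_Ico, mem_preimage]
      constructor <;> rintro ⟨h, h'⟩ <;> constructor <;> linarith
    rw [hpre]
    exact (measurePreserving_sub_right volume ψ).setLIntegral_comp_preimage_emb
      (MeasurableEquiv.subRight ψ).measurableEmbedding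
      (fun φ => negPow s (‖z - w‖ ^ 2 + 4 * (z.re * w.re) * Real.sin (φ / 2) ^ 2)) _
  rw [h0 ψ, kernel]
  congr 1
  rw [← h0 0]
  simp_rw [rot_zero]

/-- The measure `du / π` on the line. -/
noncomputable def lineMeasure : Measure ℝ := ENNReal.ofReal (1 / Real.pi) • volume

instance : SFinite lineMeasure := by unfold lineMeasure; infer_instance

/-- The integrand of `𝒦_s^{(R)}` with respect to the arc length `u = R φ`. -/
noncomputable def arcIntegrand (s R u : ℝ) (z w : ℂ) : ℝ≥0∞ :=
  if u ∈ Ioc (-(Real.pi * R)) (Real.pi * R) then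
    negPow s (‖z - w‖ ^ 2 + 4 * ((R + z.re) * (R + w.re)) * Real.sin (u / (2 * R)) ^ 2) else 0

lemma continuous_arcIntegrand (s R u : ℝ) :
    Continuous (Function.uncurry (arcIntegrand s R u)) := by
  unfold Function.uncurry arcIntegrand
  split_ifs
  · exact (continuous_negPow s).comp (by fun_prop)
  · exact continuous_const

lemma measurable_arcIntegrand (s R : ℝ) :
    Measurable fun q : ℝ × ℂ × ℂ => arcIntegrand s R q.1 q.2.1 q.2.2 := by
  unfold arcIntegrand
  refine Measurable.ite (measurable_fst measurableSet_Ioc) ?_ measurable_const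
  exact (continuous_negPow s).measurable.comp (by fun_prop)

lemma kernelAt_eq_lintegral (s : ℝ) {R : ℝ} (hR : 0 < R) :
    kernelAt s R = fun z w => ∫⁻ u, arcIntegrand s R u z w ∂lineMeasure := by
  ext z w
  have hpi := Real.pi_pos
  set p : ℝ := ‖z - w‖ ^ 2
  set q : ℝ := 4 * ((R + z.re) * (R + w.re))
  have h0 : kernel s ((R : ℂ) + z) ((R : ℂ) + w) = ENNReal.ofReal (1 / (2 * Real.pi)) *
      ∫⁻ φ in Ioc (-Real.pi) Real.pi, negPow s (p + q * Real.sin (φ / 2) ^ 2) := by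
    have h1 := setLIntegral_Ico_eq_of_periodic (by positivity : 0 < 2 * Real.pi)
      (periodic_negPow_sin s p q) 0 (-Real.pi)
    rw [zero_add, show -Real.pi + 2 * Real.pi = Real.pi by ring] at h1
    rw [← h1, ← lintegral_rot_sub_rot s 0]
    simp_rw [enorm_rpow_neg, norm_rot_sub_rot_sq]
    simp [p, q]
  have h2 : ∫⁻ u, arcIntegrand s R u z w =
      ∫⁻ u in Ioc (-(Real.pi * R)) (Real.pi * R), negPow s (p + q * Real.sin (u / (2 * R)) ^ 2) := by
    rw [← lintegral_indicator measurableSet_Ioc]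
    refine lintegral_congr fun u => ?_
    simp only [arcIntegrand, indicator_apply]
    rfl
  have h3 : ∫⁻ φ in Ioc (-Real.pi) Real.pi, negPow s (p + q * Real.sin (φ / 2) ^ 2) =
      ENNReal.ofReal R⁻¹ *
      ∫⁻ u in Ioc (-(Real.pi * R)) (Real.pi * R), negPow s (p + q * Real.sin (u / (2 * R)) ^ 2) := by
    have hmap := Real.map_volume_mul_left hR.ne'
    have hpre : (fun x => R * x) ⁻¹' Ioc (-(Real.pi * R)) (Real.pi * R) =
        Ioc (-Real.pi) Real.pi := by
      ext x
      simp only [mem_preimage, mem_Ioc]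
      constructor <;> rintro ⟨h, h'⟩ <;> constructor <;> nlinarith
    have hmeas : Measurable fun u : ℝ => negPow s (p + q * Real.sin (u / (2 * R)) ^ 2) :=
      (continuous_negPow s).measurable.comp (by fun_prop)
    have h4 := setLIntegral_map (μ := volume) measurableSet_Ioc hmeas (measurable_const_mul R)
      (s := Ioc (-(Real.pi * R)) (Real.pi * R))
    rw [hmap, hpre, Measure.restrict_smul, lintegral_smul_measure, abs_of_pos (by positivity),
      smul_eq_mul] at h4
    rw [h4]
    refine lintegral_congr fun φ => ?_
    rw [mul_comm 2 R, mul_div_mul_left _ _ hR.ne']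
  -- The constants combine as `2R · 1/(2π) · R⁻¹ = 1/π`.
  rw [kernelAt, h0, lineMeasure, lintegral_smul_measure, smul_eq_mul, h2, h3, ← mul_assoc,
    ← mul_assoc, ← ENNReal.ofReal_mul (by positivity), ← ENNReal.ofReal_mul (by positivity)]
  congr 2
  field_simp

/-- Writing the power as a Gamma integral and integrating the Gaussian in `u` first gives a factor
`√(π / r)`, which lowers the exponent from `s / 2` to `(s - 1) / 2`. -/
lemma lintegral_negPow_add_sq {s : ℝ} (hs : 1 < s) {q : ℝ} (hq : 0 ≤ q) :
    ENNReal.ofReal (Real.Gamma (s / 2)) * ∫⁻ u : ℝ, negPow s (q + u ^ 2) =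
      ENNReal.ofReal (√Real.pi * Real.Gamma ((s - 1) / 2)) * negPow (s - 1) q := by
  have hpi := Real.pi_pos
  have hG : 0 < Real.Gamma ((s - 1) / 2) := Real.Gamma_pos_of_pos (by linarith)
  rw [← lintegral_const_mul' _ _ ENNReal.ofReal_ne_top]
  have h1 : ∀ u : ℝ, ENNReal.ofReal (Real.Gamma (s / 2)) * negPow s (q + u ^ 2) =
      ∫⁻ r in Ioi (0 : ℝ), ENNReal.ofReal (r ^ (s / 2 - 1) * Real.exp (-((q + u ^ 2) * r))) :=
    fun u => (lintegral_rpow_mul_exp_neg (by linarith) (by positivity)).symm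
  simp_rw [h1]
  rw [lintegral_lintegral_swap (by fun_prop), ENNReal.ofReal_mul (by positivity), mul_assoc]
  unfold negPow
  rw [← lintegral_rpow_mul_exp_neg (by linarith) hq, ← lintegral_const_mul' _ _ ENNReal.ofReal_ne_top]
  refine setLIntegral_congr_fun measurableSet_Ioi fun r hr => ?_
  have hr' : (0 : ℝ) < r := hr
  have h2 : ∀ u : ℝ, ENNReal.ofReal (r ^ (s / 2 - 1) * Real.exp (-((q + u ^ 2) * r))) =
      ENNReal.ofReal (r ^ (s / 2 - 1) * Real.exp (-(q * r))) *
        ENNReal.ofReal (Real.exp (-r * ‖u‖ ^ 2)) := by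
    intro u
    rw [← ENNReal.ofReal_mul (by positivity), mul_assoc, ← Real.exp_add, Real.norm_eq_abs, sq_abs]
    congr 3
    ring
  simp_rw [h2]
  rw [lintegral_const_mul' _ _ ENNReal.ofReal_ne_top, lintegral_exp_neg_mul_sq_norm ℝ hr',
    ← ENNReal.ofReal_mul (by positivity), ← ENNReal.ofReal_mul (by positivity)]
  congr 1
  have h3 : (s - 1) / 2 - 1 = (s / 2 - 1) - 1 / 2 := by ring
  generalize s / 2 - 1 = e at h3 ⊢
  rw [h3, Real.rpow_sub hr', Module.finrank_self, Nat.cast_one, ← Real.sqrt_eq_rpow,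
    ← Real.sqrt_eq_rpow, Real.sqrt_div hpi.le]
  ring

lemma kernelInfty_eq_lintegral {s : ℝ} (hs : 1 < s) :
    kernelInfty s = fun z w => ∫⁻ u, negPow s (‖z - w‖ ^ 2 + u ^ 2) ∂lineMeasure := by
  ext z w
  have hpi := Real.pi_pos
  have hG : 0 < Real.Gamma (s / 2) := Real.Gamma_pos_of_pos (by linarith)
  have hG' : ENNReal.ofReal (Real.Gamma (s / 2)) ≠ 0 := by simpa using hG
  have h := lintegral_negPow_add_sq hs (sq_nonneg ‖z - w‖)
  rw [← ENNReal.mul_right_inj hG' ENNReal.ofReal_ne_top, lineMeasure, lintegral_smul_measure,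
    smul_eq_mul, mul_left_comm _ (ENNReal.ofReal (1 / Real.pi)), h, ← enorm_rpow_neg, kernelInfty,
    ← mul_assoc, ← mul_assoc, ← ENNReal.ofReal_mul (by positivity),
    ← ENNReal.ofReal_mul (by positivity), neg_sub]
  congr 2
  have hsq : √Real.pi * √Real.pi = Real.pi := Real.mul_self_sqrt hpi.le
  have : √Real.pi ≠ 0 := (Real.sqrt_pos.2 hpi).ne'
  field_simp
  linear_combination -Real.Gamma ((s - 1) / 2) * hsq

/-! ### Regularity of the kernels and comparison of the integrands -/

lemma measurable_kernelAt (s : ℝ) {R : ℝ} (hR : 0 < R) :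
    Measurable (Function.uncurry (kernelAt s R)) := by
  rw [kernelAt_eq_lintegral s hR]
  have h : Measurable fun q : (ℂ × ℂ) × ℝ => arcIntegrand s R q.2 q.1.1 q.1.2 :=
    (measurable_arcIntegrand s R).comp measurable_swap
  exact h.lintegral_prod_right'

lemma kernelAt_comm (s : ℝ) {R : ℝ} (hR : 0 < R) (z w : ℂ) :
    kernelAt s R z w = kernelAt s R w z := by
  simp only [kernelAt_eq_lintegral s hR, arcIntegrand]
  rw [norm_sub_rev, mul_comm (R + z.re)]

lemma lowerSemicontinuous_energy_kernelAt (s : ℝ) {R : ℝ} (hR : 0 < R) :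
    LowerSemicontinuous (energy (kernelAt s R)) := by
  rw [kernelAt_eq_lintegral s hR]
  exact lowerSemicontinuous_energy_lintegral (continuous_arcIntegrand s R)
    (measurable_arcIntegrand s R)

lemma measurable_negPow_add_sq (s : ℝ) :
    Measurable fun q : ℝ × ℂ × ℂ => negPow s (‖q.2.1 - q.2.2‖ ^ 2 + q.1 ^ 2) :=
  (continuous_negPow s).measurable.comp (by fun_prop)

lemma continuous_negPow_add_sq (s u : ℝ) :
    Continuous (Function.uncurry fun z w : ℂ => negPow s (‖z - w‖ ^ 2 + u ^ 2)) :=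
  (continuous_negPow s).comp (by fun_prop)

lemma measurable_kernelInfty (s : ℝ) : Measurable (Function.uncurry (kernelInfty s)) := by
  unfold Function.uncurry kernelInfty
  fun_prop

lemma kernelInfty_comm (s : ℝ) (z w : ℂ) : kernelInfty s z w = kernelInfty s w z := by
  rw [kernelInfty, kernelInfty, ← neg_sub w z, enorm_neg]

lemma lowerSemicontinuous_energy_kernelInfty {s : ℝ} (hs : 1 < s) :
    LowerSemicontinuous (energy (kernelInfty s)) := by
  rw [kernelInfty_eq_lintegral hs]
  exact lowerSemicontinuous_energy_lintegral (continuous_negPow_add_sq s)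
    (measurable_negPow_add_sq s)

/-- Jordan's inequality `sin x ≥ 2x/π` on `[0, π/2]` together with distance at least `δ` from the
axis bounds the squared chord below by `c² (|z - w|² + u²)`. -/
lemma arcIntegrand_le {s R c δ u : ℝ} (hs : 0 ≤ s) (hR : 0 < R) (hc0 : 0 < c) (hc1 : c ≤ 1)
    (hδ : 0 ≤ δ) (hc : c * (Real.pi * R) ≤ 2 * δ) {z w : ℂ} (hz : δ ≤ R + z.re)
    (hw : δ ≤ R + w.re) :
    arcIntegrand s R u z w ≤ ENNReal.ofReal (c ^ (-s)) * negPow s (‖z - w‖ ^ 2 + u ^ 2) := by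
  unfold arcIntegrand
  split_ifs with hu
  swap
  · exact zero_le
  rw [← negPow_sq_mul s hc0]
  refine negPow_le_negPow hs ?_
  have hpi := Real.pi_pos
  have hsin : (2 / Real.pi * (|u| / (2 * R))) ^ 2 ≤ Real.sin (u / (2 * R)) ^ 2 := by
    have h1 : Real.sin (u / (2 * R)) ^ 2 = Real.sin (|u| / (2 * R)) ^ 2 := by
      rcases abs_choice u with h | h <;> rw [h]
      rw [neg_div, Real.sin_neg, neg_sq]
    rw [h1]
    refine pow_le_pow_left₀ (by positivity) (Real.mul_le_sin (by positivity) ?_) 2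
    rw [div_le_div_iff₀ (by positivity) two_pos]
    have : |u| ≤ Real.pi * R := abs_le.2 ⟨hu.1.le, hu.2⟩
    linarith
  have hab : δ ^ 2 ≤ (R + z.re) * (R + w.re) := by
    rw [sq]; exact mul_le_mul hz hw hδ (hδ.trans hz)
  have hkey : c ^ 2 * u ^ 2 ≤ 4 * δ ^ 2 * (2 / Real.pi * (|u| / (2 * R))) ^ 2 := by
    have h2 : 4 * δ ^ 2 * (2 / Real.pi * (|u| / (2 * R))) ^ 2 =
        (2 * δ / (Real.pi * R)) ^ 2 * |u| ^ 2 := by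
      field_simp
      ring
    rw [h2, sq_abs]
    gcongr
    rwa [le_div_iff₀ (by positivity)]
  have h3 : c ^ 2 * ‖z - w‖ ^ 2 ≤ ‖z - w‖ ^ 2 :=
    mul_le_of_le_one_left (by positivity) (pow_le_one₀ hc0.le hc1)
  calc c ^ 2 * (‖z - w‖ ^ 2 + u ^ 2) = c ^ 2 * ‖z - w‖ ^ 2 + c ^ 2 * u ^ 2 := by ring
    _ ≤ ‖z - w‖ ^ 2 + 4 * δ ^ 2 * (2 / Real.pi * (|u| / (2 * R))) ^ 2 := add_le_add h3 hkey
    _ ≤ _ := by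
      have hab0 : 0 ≤ 4 * ((R + z.re) * (R + w.re)) := by linarith [sq_nonneg δ]
      gcongr

/-- The reverse comparison, from `|sin x| ≤ |x|`. Its constant tends to 1 with `κ`, which the limit
argument needs. -/
lemma negPow_le_arcIntegrand {s R κ u : ℝ} (hs : 0 ≤ s) (hR : 0 < R) (hκ : 1 ≤ κ)
    (hu : u ∈ Ioc (-(Real.pi * R)) (Real.pi * R)) {z w : ℂ} (hz : |R + z.re| ≤ κ * R)
    (hw : |R + w.re| ≤ κ * R) :
    negPow s (‖z - w‖ ^ 2 + u ^ 2) ≤ ENNReal.ofReal (κ ^ s) * arcIntegrand s R u z w := by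
  have hκ0 : 0 < κ := by linarith
  have h1 : negPow s (κ ^ 2 * (‖z - w‖ ^ 2 + u ^ 2)) ≤ arcIntegrand s R u z w := by
    unfold arcIntegrand
    rw [if_pos hu]
    refine negPow_le_negPow hs ?_
    have hab : (R + z.re) * (R + w.re) ≤ (κ * R) ^ 2 := by
      refine (le_abs_self _).trans ?_
      rw [abs_mul, sq]
      exact mul_le_mul hz hw (abs_nonneg _) (by positivity)
    have hsin : Real.sin (u / (2 * R)) ^ 2 ≤ (u / (2 * R)) ^ 2 :=
      sq_le_sq.2 Real.abs_sin_le_abs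
    calc ‖z - w‖ ^ 2 + 4 * ((R + z.re) * (R + w.re)) * Real.sin (u / (2 * R)) ^ 2
        ≤ ‖z - w‖ ^ 2 + 4 * (κ * R) ^ 2 * (u / (2 * R)) ^ 2 := by gcongr
      _ = ‖z - w‖ ^ 2 + κ ^ 2 * u ^ 2 := by field_simp; ring
      _ ≤ κ ^ 2 * ‖z - w‖ ^ 2 + κ ^ 2 * u ^ 2 := by
        gcongr
        exact le_mul_of_one_le_left (by positivity) (one_le_pow₀ hκ)
      _ = _ := by ring
  calc negPow s (‖z - w‖ ^ 2 + u ^ 2)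
      = ENNReal.ofReal (κ ^ s) * negPow s (κ ^ 2 * (‖z - w‖ ^ 2 + u ^ 2)) := by
        rw [negPow_sq_mul s hκ0, ← mul_assoc, ← ENNReal.ofReal_mul (by positivity),
          ← Real.rpow_add hκ0, add_neg_cancel, Real.rpow_zero, ENNReal.ofReal_one, one_mul]
    _ ≤ _ := by gcongr

lemma ae_prod_mem {A : Set ℂ} {μ : ProbabilityMeasure ℂ} (hμ : μ ∈ measuresOn A) :
    ∀ᵐ p : ℂ × ℂ ∂((μ : Measure ℂ).prod (μ : Measure ℂ)), p.1 ∈ A ∧ p.2 ∈ A := by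
  have h : ∀ᵐ z ∂(μ : Measure ℂ), z ∈ A := mem_ae_iff.2 hμ
  exact (Measure.quasiMeasurePreserving_fst.ae h).and (Measure.quasiMeasurePreserving_snd.ae h)

lemma energy_kernelAt_ne_top {A : Set ℂ} (hA : IsCompact A) {s R : ℝ} (hs : 1 < s) (hR : 0 < R)
    (hRA : ∀ z ∈ A, 0 < R + z.re) {μ : ProbabilityMeasure ℂ} (hμ : μ ∈ measuresOn A)
    (hfin : energy (kernelInfty s) μ ≠ ∞) : energy (kernelAt s R) μ ≠ ∞ := by
  obtain ⟨δ, hδ, hδA⟩ : ∃ δ : ℝ, 0 < δ ∧ ∀ z ∈ A, δ ≤ R + z.re := by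
    rcases A.eq_empty_or_nonempty with rfl | hne
    · exact ⟨1, one_pos, by simp⟩
    obtain ⟨z, hz, hmin⟩ := hA.exists_isMinOn hne
      (f := fun z : ℂ => R + z.re) (by fun_prop)
    exact ⟨R + z.re, hRA z hz, fun w hw => isMinOn_iff.1 hmin w hw⟩
  have hpi := Real.pi_pos
  set c : ℝ := min 1 (2 * δ / (Real.pi * R)) with hc
  have hc0 : 0 < c := by positivity
  have hcR : c * (Real.pi * R) ≤ 2 * δ := by
    rw [← le_div_iff₀ (by positivity)]
    exact min_le_right _ _
  rw [kernelInfty_eq_lintegral hs, energy_lintegral (measurable_negPow_add_sq s)] at hfin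
  rw [kernelAt_eq_lintegral s hR, energy_lintegral (measurable_arcIntegrand s R)]
  refine ne_top_of_le_ne_top (ENNReal.mul_ne_top (ENNReal.ofReal_ne_top (r := c ^ (-s))) hfin) ?_
  rw [← lintegral_const_mul' _ _ ENNReal.ofReal_ne_top]
  refine lintegral_mono fun u => ?_
  rw [← lintegral_const_mul' _ _ ENNReal.ofReal_ne_top]
  refine lintegral_mono_ae ?_
  filter_upwards [ae_prod_mem hμ] with p hp
  exact arcIntegrand_le (by linarith) hR hc0 (min_le_left _ _) hδ.le hcR (hδA _ hp.1) (hδA _ hp.2)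

/-! ### Measures of revolution and uniqueness of equilibrium measures -/

/-- The uniform probability measure on the circle of angles. -/
noncomputable def angleMeasure : Measure ℝ :=
  ENNReal.ofReal (1 / (2 * Real.pi)) • volume.restrict (Ico (0 : ℝ) (2 * Real.pi))

instance : IsProbabilityMeasure angleMeasure := by
  refine ⟨?_⟩
  have hpi := Real.pi_pos
  simp only [angleMeasure, Measure.smul_apply, Measure.restrict_apply_univ, Real.volume_Ico,
    smul_eq_mul]
  rw [← ENNReal.ofReal_mul (by positivity), sub_zero, one_div, inv_mul_cancel₀ (by positivity),
    ENNReal.ofReal_one]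

lemma measurable_revolve (R : ℝ) :
    Measurable fun q : ℝ × ℂ => rot q.1 (embed ((R : ℂ) + q.2)) := by
  have h : Continuous fun q : ℝ × ℂ => rot q.1 (embed ((R : ℂ) + q.2)) := by
    unfold rot embed
    refine (PiLp.continuous_toLp 2 _).comp (continuous_pi fun i => ?_)
    fin_cases i <;> simp <;> fun_prop
  exact h.measurable

/-- The measure of revolution in `ℝ³` generated by the translate by `R` of a planar measure. -/
noncomputable def revolve (R : ℝ) (μ : Measure ℂ) : Measure (EuclideanSpace ℝ (Fin 3)) :=
  (angleMeasure.prod μ).map fun q => rot q.1 (embed ((R : ℂ) + q.2))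

instance (R : ℝ) (μ : Measure ℂ) [IsFiniteMeasure μ] : IsFiniteMeasure (revolve R μ) := by
  unfold revolve; infer_instance

/-- By rotation invariance, integrating out the first angle already gives the kernel for every value
of the second, and the second integration is against a probability measure. -/
lemma mutualEnergy_revolve (s : ℝ) {R : ℝ} (hR : 0 < R) (μ ν : Measure ℂ) [SFinite μ] [SFinite ν] :
    mutualEnergy (kernelAt s R) μ ν = ENNReal.ofReal (2 * R) *
      mutualEnergy (fun x y : EuclideanSpace ℝ (Fin 3) => ‖x - y‖ₑ ^ (-s))
        (revolve R μ) (revolve R ν) := by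
  have hT := measurable_revolve R
  have h1 : ∀ y : EuclideanSpace ℝ (Fin 3), ∫⁻ x, ‖x - y‖ₑ ^ (-s) ∂(revolve R μ) =
      ∫⁻ q, ‖rot q.1 (embed ((R : ℂ) + q.2)) - y‖ₑ ^ (-s) ∂(angleMeasure.prod μ) := fun y =>
    lintegral_map (by fun_prop) hT
  have h2 : ∀ (ψ : ℝ) (w : ℂ), ∫⁻ q, ‖rot q.1 (embed ((R : ℂ) + q.2)) -
      rot ψ (embed ((R : ℂ) + w))‖ₑ ^ (-s) ∂(angleMeasure.prod μ) =
      ∫⁻ z, kernel s (R + z) (R + w) ∂μ := by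
    intro ψ w
    have hm : Measurable fun q : ℝ × ℂ => ‖rot q.1 (embed ((R : ℂ) + q.2)) -
      rot ψ (embed ((R : ℂ) + w))‖ₑ ^ (-s) := (hT.sub_const _).enorm.pow_const _
    rw [lintegral_prod_symm' _ hm]
    refine lintegral_congr fun z => ?_
    rw [← lintegral_rot_sub_rot s ψ, angleMeasure, lintegral_smul_measure, smul_eq_mul]
  have h3 : Measurable fun y : EuclideanSpace ℝ (Fin 3) =>
      ∫⁻ q, ‖rot q.1 (embed ((R : ℂ) + q.2)) - y‖ₑ ^ (-s) ∂(angleMeasure.prod μ) := by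
    have : Measurable fun p : EuclideanSpace ℝ (Fin 3) × (ℝ × ℂ) =>
        ‖rot p.2.1 (embed ((R : ℂ) + p.2.2)) - p.1‖ₑ ^ (-s) :=
      ((hT.comp measurable_snd).sub measurable_fst).enorm.pow_const _
    exact this.lintegral_prod_right'
  unfold mutualEnergy
  simp_rw [h1]
  rw [revolve, lintegral_map h3 hT]
  simp_rw [h2]
  rw [← lintegral_const_mul' _ _ ENNReal.ofReal_ne_top]
  simp_rw [← lintegral_const_mul' _ _ (ENNReal.ofReal_ne_top (r := 2 * R))]
  have h4 : Measurable fun w => ∫⁻ z, kernelAt s R z w ∂μ := by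
    exact ((measurable_kernelAt s hR).comp measurable_swap).lintegral_prod_right'
  have h5 := lintegral_prod_symm' (μ := angleMeasure) (ν := ν)
    (fun q : ℝ × ℂ => ∫⁻ z, kernelAt s R z q.2 ∂μ) (h4.comp measurable_snd)
  simp only [lintegral_const, measure_univ, mul_one] at h5
  exact h5.symm

lemma eq_of_revolve_eq {A : Set ℂ} {R : ℝ} (hRA : ∀ z ∈ A, 0 < R + z.re)
    {μ ν : ProbabilityMeasure ℂ} (hμ : μ ∈ measuresOn A) (hν : ν ∈ measuresOn A)
    (h : revolve R (μ : Measure ℂ) = revolve R (ν : Measure ℂ)) : μ = ν := by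
  -- A left inverse of spinning: distance to the axis shifted by `-R`, and height. Positivity of `R
  -- + z.re` on `A` is what makes the distance recover the real part.
  let P : EuclideanSpace ℝ (Fin 3) → ℂ := fun p => ⟨√(p 0 ^ 2 + p 2 ^ 2) - R, p 1⟩
  have hP : Measurable P := by
    have : Measurable fun p : EuclideanSpace ℝ (Fin 3) =>
        Complex.equivRealProd.symm (√(p 0 ^ 2 + p 2 ^ 2) - R, p 1) :=
      Complex.measurableEquivRealProd.symm.measurable.comp (by fun_prop)
    exact this
  have hmap : ∀ ρ ∈ measuresOn A, (revolve R (ρ : Measure ℂ)).map P = (ρ : Measure ℂ) := by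
    intro ρ hρ
    rw [revolve, Measure.map_map hP (measurable_revolve R)]
    have hae : (P ∘ fun q : ℝ × ℂ => rot q.1 (embed ((R : ℂ) + q.2)))
        =ᵐ[angleMeasure.prod (ρ : Measure ℂ)] Prod.snd := by
      have h0 : ∀ᵐ z ∂(ρ : Measure ℂ), z ∈ A := mem_ae_iff.2 hρ
      filter_upwards [Measure.quasiMeasurePreserving_snd.ae h0] with q hq
      have h1 : (Real.cos q.1 * (R + q.2.re)) ^ 2 + (Real.sin q.1 * (R + q.2.re)) ^ 2 =
          (R + q.2.re) ^ 2 := by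
        linear_combination (R + q.2.re) ^ 2 * Real.sin_sq_add_cos_sq q.1
      apply Complex.ext
      · simp [P, rot, embed, h1, Real.sqrt_sq (hRA _ hq).le]
      · simp [P, rot, embed]
    rw [Measure.map_congr hae, Measure.map_snd_prod]
    simp
  apply Subtype.ext
  change (μ : Measure ℂ) = (ν : Measure ℂ)
  rw [← hmap μ hμ, ← hmap ν hν, h]

lemma eq_of_const_mul_rieszEnergy_le {E : Type*} [NormedAddCommGroup E] [InnerProductSpace ℝ E]
    [FiniteDimensional ℝ E] [MeasurableSpace E] [BorelSpace E] {s : ℝ} (hs : 0 < s)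
    {μ ν : Measure E} [IsFiniteMeasure μ] [IsFiniteMeasure ν] {c e : ℝ≥0∞} (hc0 : c ≠ 0)
    (hc : c ≠ ∞) (he : e ≠ ∞)
    (hμ : c * mutualEnergy (fun x y : E => ‖x - y‖ₑ ^ (-s)) μ μ ≤ e)
    (hν : c * mutualEnergy (fun x y : E => ‖x - y‖ₑ ^ (-s)) ν ν ≤ e)
    (hμν : e ≤ c * mutualEnergy (fun x y : E => ‖x - y‖ₑ ^ (-s)) μ ν) : μ = ν := by
  refine eq_of_rieszEnergy_le hs (e := e / c) (ENNReal.div_ne_top he hc0) ?_ ?_ ?_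
  · rwa [ENNReal.le_div_iff_mul_le (Or.inl hc0) (Or.inl hc), mul_comm]
  · rwa [ENNReal.le_div_iff_mul_le (Or.inl hc0) (Or.inl hc), mul_comm]
  · exact ENNReal.div_le_of_le_mul' hμν

theorem existsUnique_isEquilibrium_kernelAt {A : Set ℂ} (hA : IsCompact A) {s R : ℝ} (hs : 1 < s)
    (hR : 0 < R) (hRA : ∀ z ∈ A, 0 < R + z.re)
    (hfin : ∃ ν ∈ measuresOn A, energy (kernelInfty s) ν ≠ ∞) :
    ∃! μ : ProbabilityMeasure ℂ, IsEquilibrium A (kernelAt s R) μ := by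
  obtain ⟨ν₀, hν₀, hν₀fin⟩ := hfin
  refine existsUnique_isEquilibrium hA (measurable_kernelAt s hR) (kernelAt_comm s hR)
    (lowerSemicontinuous_energy_kernelAt s hR)
    ⟨ν₀, hν₀, energy_kernelAt_ne_top hA hs hR hRA hν₀ hν₀fin⟩
    fun μ hμ ν hν e he h1 h2 h3 => eq_of_revolve_eq hRA hμ hν ?_
  rw [energy_eq_mutualEnergy, mutualEnergy_revolve s hR] at h1 h2
  rw [mutualEnergy_revolve s hR] at h3
  exact eq_of_const_mul_rieszEnergy_le (by linarith) (by simpa using hR) ENNReal.ofReal_ne_top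
    he h1 h2 h3

theorem existsUnique_isEquilibrium_kernelInfty {A : Set ℂ} (hA : IsCompact A) {s : ℝ} (hs : 1 < s)
    (hfin : ∃ ν ∈ measuresOn A, energy (kernelInfty s) ν ≠ ∞) :
    ∃! μ : ProbabilityMeasure ℂ, IsEquilibrium A (kernelInfty s) μ := by
  set c : ℝ≥0∞ :=
    ENNReal.ofReal (Real.Gamma ((s - 1) / 2) / (√Real.pi * Real.Gamma (s / 2))) with hc
  have hc0 : c ≠ 0 := by
    have h1 : 0 < Real.Gamma ((s - 1) / 2) := Real.Gamma_pos_of_pos (by linarith)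
    have h2 : 0 < Real.Gamma (s / 2) := Real.Gamma_pos_of_pos (by linarith)
    have hpi := Real.pi_pos
    rw [hc, Ne, ENNReal.ofReal_eq_zero, not_le]
    positivity
  have hmutual : ∀ μ ν : Measure ℂ, mutualEnergy (kernelInfty s) μ ν =
      c * mutualEnergy (fun x y : ℂ => ‖x - y‖ₑ ^ (-(s - 1))) μ ν := by
    intro μ ν
    unfold mutualEnergy
    simp_rw [← lintegral_const_mul' c _ ENNReal.ofReal_ne_top, neg_sub]
    rfl
  refine existsUnique_isEquilibrium hA (measurable_kernelInfty s) (kernelInfty_comm s)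
    (lowerSemicontinuous_energy_kernelInfty hs) hfin
    fun μ hμ ν hν e he h1 h2 h3 => Subtype.ext ?_
  rw [energy_eq_mutualEnergy, hmutual] at h1 h2
  rw [hmutual] at h3
  change (μ : Measure ℂ) = (ν : Measure ℂ)
  exact eq_of_const_mul_rieszEnergy_le (by linarith) hc0 ENNReal.ofReal_ne_top he h1 h2 h3

/-! ### The limit of large radius -/

lemma tendsto_arcLength {p x y u : ℝ} : Tendsto (fun R : ℝ =>
    p + 4 * ((R + x) * (R + y)) * Real.sin (u / (2 * R)) ^ 2) atTop (𝓝 (p + u ^ 2)) := by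
  have hsin : Tendsto (fun R : ℝ => (2 * R) * Real.sin (u / (2 * R))) atTop (𝓝 u) := by
    have h1 : HasDerivAt (fun h : ℝ => Real.sin (u * h)) u 0 := by
      have h2 := (hasDerivAt_id (0 : ℝ)).const_mul u
      have h3 := h2.sin
      simpa using h3
    have h4 := h1.tendsto_slope_zero
    have h5 : Tendsto (fun R : ℝ => (2 * R)⁻¹) atTop (𝓝[≠] 0) := by
      have h6 : Tendsto (fun R : ℝ => 2 * R) atTop atTop :=
        tendsto_id.const_mul_atTop two_pos
      exact (tendsto_inv_atTop_nhdsGT_zero.comp h6).mono_right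
        (nhdsWithin_mono _ fun x hx => ne_of_gt hx)
    have h7 := h4.comp h5
    refine h7.congr fun R => ?_
    simp [div_eq_mul_inv]
  have hratio : ∀ x : ℝ, Tendsto (fun R : ℝ => 1 + x / R) atTop (𝓝 1) := fun x => by
    have := (tendsto_const_nhds (x := (1 : ℝ))).add
      (tendsto_const_nhds (x := x).div_atTop (tendsto_id (α := ℝ)))
    simpa using this
  have h := ((((hratio x).mul (hratio y)).mul (hsin.pow 2))).const_add p
  rw [one_mul, one_mul] at h
  refine h.congr' ?_
  filter_upwards [eventually_gt_atTop 0] with R hR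
  have : R ≠ 0 := hR.ne'
  field_simp
  ring

lemma tendsto_arcIntegrand (s u : ℝ) (z w : ℂ) :
    Tendsto (fun R => arcIntegrand s R u z w) atTop (𝓝 (negPow s (‖z - w‖ ^ 2 + u ^ 2))) := by
  have h := ((continuous_negPow s).tendsto _).comp
    (tendsto_arcLength (p := ‖z - w‖ ^ 2) (x := z.re) (y := w.re) (u := u))
  refine h.congr' ?_
  filter_upwards [eventually_gt_atTop |u|] with R hR
  have h3 := Real.pi_gt_three
  have hR0 : 0 < R := (abs_nonneg u).trans_lt hR
  have hu : u ∈ Ioc (-(Real.pi * R)) (Real.pi * R) := by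
    have := abs_lt.1 hR
    constructor <;> nlinarith
  rw [arcIntegrand, if_pos hu]
  rfl

/-- The energies of a fixed measure of finite limit energy converge. -/
theorem tendsto_energy_kernelAt {A : Set ℂ} (hA : IsCompact A) {s : ℝ} (hs : 1 < s)
    {μ : ProbabilityMeasure ℂ} (hμ : μ ∈ measuresOn A) (hfin : energy (kernelInfty s) μ ≠ ∞) :
    Tendsto (fun R => energy (kernelAt s R) μ) atTop (𝓝 (energy (kernelInfty s) μ)) := by
  obtain ⟨C, hC⟩ := hA.isBounded.exists_norm_le
  have hpi := Real.pi_pos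
  have hmInf : Measurable fun q : ℝ × ℂ × ℂ => negPow s (‖q.2.1 - q.2.2‖ ^ 2 + q.1 ^ 2) :=
    measurable_negPow_add_sq s
  set m : Measure (ℝ × ℂ × ℂ) :=
    lineMeasure.prod ((μ : Measure ℂ).prod (μ : Measure ℂ)) with hm
  have hInf : energy (kernelInfty s) μ =
      ∫⁻ q, negPow s (‖q.2.1 - q.2.2‖ ^ 2 + q.1 ^ 2) ∂m := by
    rw [kernelInfty_eq_lintegral hs, energy_lintegral hmInf, hm, lintegral_prod _ hmInf.aemeasurable]
  have hAt : ∀ R, 0 < R → energy (kernelAt s R) μ =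
      ∫⁻ q, arcIntegrand s R q.1 q.2.1 q.2.2 ∂m := fun R hR => by
    rw [kernelAt_eq_lintegral s hR, energy_lintegral (measurable_arcIntegrand s R), hm,
      lintegral_prod _ (measurable_arcIntegrand s R).aemeasurable]
  rw [hInf] at hfin ⊢
  have hlim : Tendsto (fun R => ∫⁻ q, arcIntegrand s R q.1 q.2.1 q.2.2 ∂m) atTop
      (𝓝 (∫⁻ q, negPow s (‖q.2.1 - q.2.2‖ ^ 2 + q.1 ^ 2) ∂m)) := by
    refine tendsto_lintegral_filter_of_dominated_convergence
      (fun q => ENNReal.ofReal ((1 / Real.pi) ^ (-s)) * negPow s (‖q.2.1 - q.2.2‖ ^ 2 + q.1 ^ 2))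
      (Eventually.of_forall fun R => measurable_arcIntegrand s R) ?_ ?_
      (Eventually.of_forall fun q => tendsto_arcIntegrand s q.1 q.2.1 q.2.2)
    · filter_upwards [eventually_gt_atTop 0, eventually_ge_atTop (2 * C)] with R hR hRC
      have hae : ∀ᵐ q : ℝ × ℂ × ℂ ∂m, q.2.1 ∈ A ∧ q.2.2 ∈ A :=
        Measure.quasiMeasurePreserving_snd.ae (ae_prod_mem hμ)
      have hre : ∀ z ∈ A, R / 2 ≤ R + z.re := fun z hz => by
        have := (abs_le.1 ((Complex.abs_re_le_norm z).trans (hC z hz))).1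
        linarith
      filter_upwards [hae] with q hq
      -- Here `δ = R / 2` and `c = 1 / π`, so `c π R = 2 δ` and the dominating constant does not
      -- depend on `R`.
      refine arcIntegrand_le (by linarith) hR (by positivity) ?_ (by positivity) ?_
        (hre _ hq.1) (hre _ hq.2)
      · rw [div_le_one hpi]; linarith [Real.pi_gt_three]
      · field_simp
        exact le_rfl
    · rw [lintegral_const_mul' _ _ ENNReal.ofReal_ne_top]
      exact ENNReal.mul_ne_top ENNReal.ofReal_ne_top hfin
  refine hlim.congr' ?_
  filter_upwards [eventually_gt_atTop 0] with R hR using (hAt R hR).symm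

/-- Lower semicontinuity of the energies along `R → ∞`. -/
theorem energy_kernelInfty_le_liminf {A : Set ℂ} (hA : IsCompact A) {s : ℝ} (hs : 1 < s)
    -- A general countably generated `F` lets Fatou run along the filter that selects a cluster
    -- point, without extracting a sequence.
    {F : Filter ℝ} [F.IsCountablyGenerated] (hF : F ≤ atTop) {lam : ℝ → ProbabilityMeasure ℂ}
    {μ : ProbabilityMeasure ℂ} (hlam : Tendsto lam F (𝓝 μ))
    (hmem : ∀ᶠ R in F, lam R ∈ measuresOn A) :
    ∃ κ : ℝ → ℝ, Tendsto κ atTop (𝓝 1) ∧ energy (kernelInfty s) μ ≤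
      liminf (fun R => ENNReal.ofReal (κ R) * energy (kernelAt s R) (lam R)) F := by
  obtain ⟨C, hC0, hC⟩ := hA.isBounded.exists_pos_norm_le
  have hκ : Tendsto (fun R : ℝ => 1 + C / R) atTop (𝓝 1) := by
    have := (tendsto_const_nhds (x := (1 : ℝ))).add
      (tendsto_const_nhds (x := C).div_atTop (tendsto_id (α := ℝ)))
    simpa using this
  refine ⟨fun R => (1 + C / R) ^ s, ?_, ?_⟩
  · have h := hκ.rpow_const (p := s) (Or.inl one_ne_zero)
    rwa [Real.one_rpow] at h
  have hpi := Real.pi_pos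
  have hm := measurable_negPow_add_sq s
  let I : ℝ → ℝ → ℝ≥0∞ := fun u R => ∫⁻ p : ℂ × ℂ,
    negPow s (‖p.1 - p.2‖ ^ 2 + u ^ 2) ∂((lam R : Measure ℂ).prod (lam R : Measure ℂ))
  let W : ℝ → Set ℝ := fun R => Ioc (-(Real.pi * R)) (Real.pi * R)
  rw [kernelInfty_eq_lintegral hs, energy_lintegral hm]
  calc ∫⁻ u, ∫⁻ p : ℂ × ℂ, negPow s (‖p.1 - p.2‖ ^ 2 + u ^ 2)
        ∂((μ : Measure ℂ).prod (μ : Measure ℂ)) ∂lineMeasure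
      ≤ ∫⁻ u, liminf (fun R => (W R).indicator (fun u => I u R) u) F ∂lineMeasure := by
        refine lintegral_mono fun u => ?_
        have h1 := (lowerSemicontinuous_lintegral_prod (continuous_negPow_add_sq s u)).le_liminf μ
        refine (h1.trans hlam.liminf_le_liminf_comp).trans (le_of_eq ?_)
        refine liminf_congr ?_
        filter_upwards [hF (eventually_gt_atTop |u|)] with R hR
        have h3 := Real.pi_gt_three
        have hR0 : 0 < R := (abs_nonneg u).trans_lt hR
        have hu : u ∈ W R := by
          have := abs_lt.1 hR
          constructor <;> nlinarith
        rw [indicator_of_mem hu]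
        rfl
    _ ≤ liminf (fun R => ∫⁻ u, (W R).indicator (fun u => I u R) u ∂lineMeasure) F :=
        lintegral_liminf_le fun R => (hm.lintegral_prod_right' (ν :=
          (lam R : Measure ℂ).prod (lam R : Measure ℂ))).indicator measurableSet_Ioc
    _ ≤ _ := by
        refine liminf_le_liminf ?_
        filter_upwards [hF (eventually_gt_atTop 0), hmem] with R hR hR2
        rw [kernelAt_eq_lintegral s hR, energy_lintegral (measurable_arcIntegrand s R),
          ← lintegral_const_mul' _ _ ENNReal.ofReal_ne_top]
        refine lintegral_mono fun u => ?_
        by_cases hu : u ∈ W R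
        · rw [indicator_of_mem hu, ← lintegral_const_mul' _ _ ENNReal.ofReal_ne_top]
          refine lintegral_mono_ae ?_
          have hre : ∀ z ∈ A, |R + z.re| ≤ (1 + C / R) * R := fun z hz => by
            have h4 := (Complex.abs_re_le_norm z).trans (hC z hz)
            calc |R + z.re| ≤ |R| + |z.re| := abs_add_le _ _
              _ ≤ R + C := by rw [abs_of_pos hR]; linarith
              _ = (1 + C / R) * R := by field_simp
          filter_upwards [ae_prod_mem hR2] with p hp
          refine negPow_le_arcIntegrand (by linarith) hR ?_ hu (hre _ hp.1) (hre _ hp.2)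
          have : 0 ≤ C / R := by positivity
          linarith
        · rw [indicator_of_notMem hu]
          exact zero_le

theorem tendsto_equilibrium {A : Set ℂ} (hA : IsCompact A) {s : ℝ} (hs : 1 < s)
    (hfin : ∃ ν ∈ measuresOn A, energy (kernelInfty s) ν ≠ ∞) {lam : ℝ → ProbabilityMeasure ℂ}
    {lamInfty : ProbabilityMeasure ℂ} (hlam : ∀ᶠ R in atTop, IsEquilibrium A (kernelAt s R) (lam R))
    (hInfty : IsEquilibrium A (kernelInfty s) lamInfty) : Tendsto lam atTop (𝓝 lamInfty) := by
  have hcompact := isCompact_measuresOn hA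
  obtain ⟨ν₀, hν₀, hν₀fin⟩ := hfin
  have hfinInfty : energy (kernelInfty s) lamInfty ≠ ∞ :=
    ne_top_of_le_ne_top hν₀fin (hInfty.2 ν₀ hν₀)
  refine hcompact.tendsto_nhds_of_unique_mapClusterPt (hlam.mono fun R hR => hR.1)
    fun μ hμ hcl => ?_
  refine (existsUnique_isEquilibrium_kernelInfty hA hs ⟨ν₀, hν₀, hν₀fin⟩).unique ⟨hμ, ?_⟩ hInfty
  suffices h : energy (kernelInfty s) μ ≤ energy (kernelInfty s) lamInfty from
    fun ν hν => h.trans (hInfty.2 ν hν)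
  -- Along `F` the measures `lam R` converge to the cluster point `μ`. Then the limit energy of `μ`
  -- is at most the liminf of `κ R` times the minimal energies, which are bounded by the energies of
  -- `lamInfty`, and these converge.
  set F : Filter ℝ := atTop ⊓ comap lam (𝓝 μ) with hFdef
  have hFne : F.NeBot := by
    rw [hFdef, neBot_inf_comap_iff_map, inf_comm]
    exact hcl
  obtain ⟨κ, hκ, hle⟩ := energy_kernelInfty_le_liminf hA hs (F := F) inf_le_left
    (tendsto_comap.mono_left inf_le_right) ((hlam.mono fun R hR => hR.1).filter_mono inf_le_left)
  refine hle.trans ?_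
  have hlim : Tendsto (fun R => ENNReal.ofReal (κ R) * energy (kernelAt s R) lamInfty) F
      (𝓝 (energy (kernelInfty s) lamInfty)) := by
    have h1 := ENNReal.tendsto_ofReal hκ
    rw [ENNReal.ofReal_one] at h1
    have h2 := ENNReal.Tendsto.mul h1 (Or.inl one_ne_zero)
      (tendsto_energy_kernelAt hA hs hInfty.1 hfinInfty) (Or.inr ENNReal.one_ne_top)
    rw [one_mul] at h2
    exact h2.mono_left inf_le_left
  rw [← hlim.liminf_eq]
  refine liminf_le_liminf ?_
  filter_upwards [hlam.filter_mono (inf_le_left : F ≤ atTop)] with R hR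
  gcongr
  exact hR.2 _ hInfty.1

theorem exists_energy_kernelInfty_ne_top {A : Set ℂ} (hA : IsCompact A) {s : ℝ} (hs : 1 < s)
    (hsA : ENNReal.ofReal s < 1 + dimH A) :
    ∃ ν ∈ measuresOn A, energy (kernelInfty s) ν ≠ ∞ := by
  have h1 : ENNReal.ofReal (s - 1) < dimH A := by
    rw [ENNReal.ofReal_sub _ zero_le_one, ENNReal.ofReal_one]
    exact ENNReal.sub_lt_of_lt_add (by simpa using hs.le) (by rwa [add_comm])
  -- An exponent strictly between `s - 1` and the dimension: below the dimension the Hausdorff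
  -- measure is infinite, so the content is nonzero; above `s - 1` leaves room for the dyadic series
  -- to converge.
  obtain ⟨t', ht1, ht2⟩ := ENNReal.lt_iff_exists_nnreal_btwn.1 h1
  have hst : s - 1 < t' := by
    rw [← ENNReal.ofReal_coe_nnreal] at ht1
    exact (ENNReal.ofReal_lt_ofReal_iff_of_nonneg (by linarith)).1 ht1
  obtain ⟨ν, hν, hfin⟩ := exists_rieszEnergy_ne_top hA (by linarith : 0 < s - 1) hst fun h => by
    have h2 := hausdorffMeasure_eq_zero_of_content (by linarith) h
    rw [hausdorffMeasure_of_lt_dimH ht2] at h2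
    exact ENNReal.top_ne_zero h2
  refine ⟨ν, hν, ?_⟩
  unfold energy kernelInfty
  simp_rw [lintegral_const_mul' _ _ ENNReal.ofReal_ne_top]
  refine ENNReal.mul_ne_top ENNReal.ofReal_ne_top ?_
  simp only [neg_sub] at hfin
  exact hfin

end Revolution

theorem lemma5p4 (A : Set ℂ) (hA : IsCompact A) (hdim : 0 < dimH A)
    (s : ℝ) (hs : 1 < s) (hsA : ENNReal.ofReal s < 1 + dimH A) :
    (∃! μ : MeasureTheory.ProbabilityMeasure ℂ,
      Revolution.IsEquilibrium A (Revolution.kernelInfty s) μ) ∧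
    (∀ R : ℝ, 0 < R → (∀ z ∈ A, 0 < R + z.re) →
      ∃! μ : MeasureTheory.ProbabilityMeasure ℂ,
        Revolution.IsEquilibrium A (Revolution.kernelAt s R) μ) ∧
    (∀ (lam : ℝ → MeasureTheory.ProbabilityMeasure ℂ)
      (lamInfty : MeasureTheory.ProbabilityMeasure ℂ),
      (∀ᶠ R in Filter.atTop, Revolution.IsEquilibrium A (Revolution.kernelAt s R) (lam R)) →
      Revolution.IsEquilibrium A (Revolution.kernelInfty s) lamInfty →
      Filter.Tendsto lam Filter.atTop (nhds lamInfty)) := by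
  have hfin := Revolution.exists_energy_kernelInfty_ne_top hA hs hsA
  exact ⟨Revolution.existsUnique_isEquilibrium_kernelInfty hA hs hfin,
    fun R hR hRA => Revolution.existsUnique_isEquilibrium_kernelAt hA hs hR hRA hfin,
    fun lam lamInfty hlam hInfty => Revolution.tendsto_equilibrium hA hs hfin hlam hInfty⟩
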